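/- **Model.** Let $\mathcal X,\mathcal S,\mathcal Y,\mathcal Z$ be finite sets, $P_S$ a pmf on $\mathcal S$, $P_{YZ|XS}(\cdot,\cdot|x,s)$ a pmf on $\mathcal Y\times\mathcal Z$ for each $(x,s)\in\mathcal X\times\mathcal S$, and $d:\mathcal S\times\mathcal S\to[0,\infty)$ a distortion function. A $(2^{nR_0},2^{nR_1},n)$ code (with $R_0,R_1\ge 0$) for this state-dependent memoryless broadcast channel with degraded message sets consists of message sets $[1:2^{nR_0}]$ and $[1:2^{nR_1}]$ (where $[1:2^{nR}]=\{1,\dots,\lceil 2^{nR}\rceil\}$), an encoder $(w_0,w_1)\mapsto x^n(w_0,w_1)\in\mathcal X^n$, a decoder $(y^n,s^n)\mapsto(\hat w_{01},\hat w_1)$ of both messages, a decoder $z^n\mapsto\hat w_{02}$ of the common message, and a state estimator $h_n:\mathcal Z^n\to\mathcal S^n$. The messages $(W_0,W_1)$ are uniform, the states $S_1,\dots,S_n$ are i.i.d. $\sim P_S$ and independent of the messages, and the channel is memoryless: given $(W_0,W_1)$ and $S^n$, the pairs $(Y_i,Z_i)$ are independent with law $P_{YZ|XS}(\cdot,\cdot|X_i,S_i)$,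 $X^n=x^n(W_0,W_1)$. Put $P_{1e}^{(n)}=\Pr\{(\hat W_{01},\hat W_1)\ne(W_0,W_1)\text{ or }\hat W_{02}\neq W_0\}$ and $D^{(n)}=\frac1n\sum_{i=1}^n\mathbb E[d(S_i,\hat S_i)]$ with $\hat S^n=h_n(Z^n)$. A tuple $(R_0,R_1,D)$ with $R_0,R_1\ge0$ is *achievable* if there is a sequence of $(2^{nR_0},2^{nR_1},n)$ codes with $\lim_n P_{1e}^{(n)}=0$ and $\limsup_n D^{(n)}\le D$. The *capacity-distortion region* is the closure of the set of achievable tuples. **Theorem.** Let $U$ be an auxiliary random variable with values in a finite set $\mathcal U$, let $P_{UX}$ be a pmf on $\mathcal U\times\mathcal X$, and let $(S,U,X,Y,Z)$ have joint law $P_{UX}P_SP_{YZ|XS}$. Let $\hat s^*(u,z)\in\arg\min_{s'\in\mathcal S}\sum_{s}P_{S|UZ}(s|u,z)\,d(s,s')$ for all $(u,z)$, and $c^*(u)=\mathbb E[d(S,\hat s^*(U,Z))\,|\,U=u]$. Information is measured in bits. 1. Let $R_0,R_1\ge0$ and $D$ satisfy $\sum_{u,x}P_{UX}(u,x)c^*(u)\le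 D$. If $$R_0\le I(U;Z),\qquad R_1\le I(X;Y|U,S),\qquad R_0+R_1\le I(X;Y|S),$$ then $(R_0,R_1,D)$ belongs to the capacity-distortion region. If each of these three inequalities is strict or has left-hand side $0$, then $(R_0,R_1,D)$ is itself achievable. 2. There are a set $\mathcal U'$ with $|\mathcal U'|\le|\mathcal X|+1$ and a pmf $P_{U'X}$ on $\mathcal U'\times\mathcal X$, with the same $X$-marginal as $P_{UX}$, such that $I(U';Z)=I(U;Z)$ and $I(X;Y|U',S)=I(X;Y|U,S)$, with $I(X;Y|S)$ unchanged; so $|\mathcal U|\le|\mathcal X|+1$ suffices for the rate constraints. With $|\mathcal U'|\le|\mathcal X|+2$ one can moreover keep the value of $\sum_{u,x}P_{UX}(u,x)c^*(u)$ (where $c^*$ for $U'$ is formed with an optimal one-shot estimator for $P_{U'X}$). -/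

import Mathlib

open Filter Topology

noncomputable section

namespace ISAC

/-! ### Finite probability: laws, expectations, mutual information (in bits) -/

/-- The law of the random variable `f` under the pmf `p` on a finite sample space. -/
def law {Ω A : Type*} [Fintype Ω] (p : Ω → ℝ) (f : Ω → A) (a : A) : ℝ :=
  ∑ ω, Set.indicator (f ⁻¹' {a}) p ω

/-- Mutual information `I(f; g)` in bits of two random variables under the pmf `p`.
Terms in which the joint probability vanishes are `0`. -/
def mutualInfo {Ω A B : Type*} [Fintype Ω] [Fintype A] [Fintype B]
    (p : Ω → ℝ) (f : Ω → A) (g : Ω → B) : ℝ :=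
  ∑ a, ∑ b, law p (fun ω => (f ω, g ω)) (a, b) *
    Real.logb 2 (law p (fun ω => (f ω, g ω)) (a, b) / (law p f a * law p g b))

/-- Conditional mutual information `I(f; g | h)` in bits,
`∑ p(a,b,c) log₂ (p(a,b,c) p(c) / (p(a,c) p(b,c)))`. -/
def condMutualInfo {Ω A B C : Type*} [Fintype Ω] [Fintype A] [Fintype B] [Fintype C]
    (p : Ω → ℝ) (f : Ω → A) (g : Ω → B) (h : Ω → C) : ℝ :=
  ∑ a, ∑ b, ∑ c, law p (fun ω => (f ω, g ω, h ω)) (a, b, c) *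
    Real.logb 2 (law p (fun ω => (f ω, g ω, h ω)) (a, b, c) * law p h c /
      (law p (fun ω => (f ω, h ω)) (a, c) * law p (fun ω => (g ω, h ω)) (b, c)))

/-! ### The channel model -/

/-- A two-receiver state-dependent memoryless broadcast channel on finite alphabets: the state
pmf `P_S`, the transition pmfs `P_{YZ|XS}`, and a (finite, hence bounded) nonnegative distortion
function `d`. -/
structure SDMBC (X S Y Z : Type*) [Fintype S] [Fintype Y] [Fintype Z] where
  /-- The state pmf. -/
  PS : S → ℝ
  PS_mem : PS ∈ stdSimplex ℝ S
  /-- The transition pmfs: `W x s (y, z) = P_{YZ|XS}(y, z | x, s)`. -/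
  W : X → S → Y × Z → ℝ
  W_mem : ∀ x s, W x s ∈ stdSimplex ℝ (Y × Z)
  /-- The distortion function: true state first, estimate second. -/
  d : S → S → ℝ
  d_nonneg : ∀ s t, 0 ≤ d s t

/-- A block code of length `n` with `M₀` common and `M₁` private messages: an encoder, a decoder
of both messages from `(y^n, s^n)`, a decoder of the common message from `z^n`, and an estimator
of the state sequence from `z^n`. -/
structure Code (X S Y Z : Type*) (n M₀ M₁ : ℕ) where
  /-- The encoder. -/
  enc : Fin M₀ → Fin M₁ → (Fin n → X)
  /-- Decoder 1, at the communication receiver. -/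
  dec₁ : (Fin n → Y) → (Fin n → S) → Fin M₀ × Fin M₁
  /-- Decoder 2, at the sensing receiver. -/
  dec₂ : (Fin n → Z) → Fin M₀
  /-- The state estimator, at the sensing receiver. -/
  est : (Fin n → Z) → (Fin n → S)

/-- Outcomes of one block: `(w₀, w₁, s^n, y^n, z^n)`. -/
abbrev Outcome (S Y Z : Type*) (n M₀ M₁ : ℕ) : Type _ :=
  Fin M₀ × Fin M₁ × (Fin n → S) × (Fin n → Y) × (Fin n → Z)

namespace SDMBC

section Operational

variable {X S Y Z : Type*} [Fintype S] [Fintype Y] [Fintype Z]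

/-- The joint pmf of messages, states and outputs: uniform messages, i.i.d. states, memoryless
channel driven by the codeword. -/
def blockPmf (ch : SDMBC X S Y Z) {n M₀ M₁ : ℕ} (c : Code X S Y Z n M₀ M₁)
    (ω : Outcome S Y Z n M₀ M₁) : ℝ :=
  match ω with
  | (w₀, w₁, s, y, z) =>
    ((M₀ : ℝ) * (M₁ : ℝ))⁻¹ * ∏ i, ch.PS (s i) * ch.W (c.enc w₀ w₁ i) (s i) (y i, z i)

/-- The average error probability: decoder 1 misses the message pair or decoder 2 misses the
common message. -/
def errorProb (ch : SDMBC X S Y Z) {n M₀ M₁ : ℕ} (c : Code X S Y Z n M₀ M₁) : ℝ :=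
  ∑ ω, Set.indicator
    {ω : Outcome S Y Z n M₀ M₁ | match ω with
      | (w₀, w₁, s, y, z) => c.dec₁ y s ≠ (w₀, w₁) ∨ c.dec₂ z ≠ w₀}
    (ch.blockPmf c) ω

/-- The expected average per-block distortion `(1/n) ∑ᵢ E d(Sᵢ, Ŝᵢ)`. -/
def expDistortion (ch : SDMBC X S Y Z) {n M₀ M₁ : ℕ} (c : Code X S Y Z n M₀ M₁) : ℝ :=
  ∑ ω : Outcome S Y Z n M₀ M₁, ch.blockPmf c ω *
    (match ω with
      | (_, _, s, _, z) => (1 / (n : ℝ)) * ∑ i, ch.d (s i) (c.est z i))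

/-- The number of messages in the message set `[1 : 2^{nR}]` (rounded up). -/
def numMessages (R : ℝ) (n : ℕ) : ℕ := ⌈(2 : ℝ) ^ ((n : ℝ) * R)⌉₊

/-- Achievability of the rate-distortion tuple `(R₀, R₁, D)`. The distortions of the codes lie in
a bounded interval, so that the real `limsup` is the true one. -/
def IsAchievable (ch : SDMBC X S Y Z) (R₀ R₁ D : ℝ) : Prop :=
  0 ≤ R₀ ∧ 0 ≤ R₁ ∧
  ∃ c : ∀ n : ℕ, Code X S Y Z n (numMessages R₀ n) (numMessages R₁ n),
    Tendsto (fun n => ch.errorProb (c n)) atTop (𝓝 0) ∧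
    limsup (fun n => ch.expDistortion (c n)) atTop ≤ D

/-- The capacity-distortion region: the closure of the set of achievable tuples. -/
def capacityDistortionRegion (ch : SDMBC X S Y Z) : Set (ℝ × ℝ × ℝ) :=
  closure {t | ch.IsAchievable t.1 t.2.1 t.2.2}

end Operational

section SingleLetter

variable {U X S Y Z : Type*} [Fintype U] [Fintype X] [Fintype S] [Fintype Y] [Fintype Z]

/-- The joint pmf `P_{UX} P_S P_{YZ|XS}` of `(U, X, S, Y, Z)`. -/
def joint (ch : SDMBC X S Y Z) (P : U × X → ℝ) (ω : U × X × S × Y × Z) : ℝ :=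
  match ω with
  | (u, x, s, y, z) => P (u, x) * ch.PS s * ch.W x s (y, z)

/-- `I(U; Z)`. -/
def infoUZ (ch : SDMBC X S Y Z) (P : U × X → ℝ) : ℝ :=
  mutualInfo (ch.joint P) (fun (u, _, _, _, _) => u) (fun (_, _, _, _, z) => z)

/-- `I(X; Y | U, S)`. -/
def infoXYgivenUS (ch : SDMBC X S Y Z) (P : U × X → ℝ) : ℝ :=
  condMutualInfo (ch.joint P) (fun (_, x, _, _, _) => x) (fun (_, _, _, y, _) => y)
    (fun (u, _, s, _, _) => (u, s))

/-- `I(X; Y | S)`. -/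
def infoXYgivenS (ch : SDMBC X S Y Z) (P : U × X → ℝ) : ℝ :=
  condMutualInfo (ch.joint P) (fun (_, x, _, _, _) => x) (fun (_, _, _, y, _) => y)
    (fun (_, _, s, _, _) => s)

/-- The posterior `P_{S|UZ}(s | u, z)` (equal to `0` when `P_{UZ}(u, z) = 0`). -/
def posterior (ch : SDMBC X S Y Z) (P : U × X → ℝ) (u : U) (z : Z) (s : S) : ℝ :=
  law (ch.joint P) (fun (u, _, s, _, z) => (s, u, z)) (s, u, z) /
    law (ch.joint P) (fun (u, _, _, _, z) => (u, z)) (u, z)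

/-- `ŝ` is an optimal one-shot estimator:
`ŝ(u, z) ∈ argmin_{s'} ∑ₛ P_{S|UZ}(s | u, z) d(s, s')` for all `u`, `z`. -/
def IsOneShotOptimal (ch : SDMBC X S Y Z) (P : U × X → ℝ) (est : U → Z → S) : Prop :=
  ∀ u z s', ∑ s, ch.posterior P u z s * ch.d s (est u z) ≤ ∑ s, ch.posterior P u z s * ch.d s s'

/-- `c(u) = E[d(S, ŝ(U, Z)) | U = u]` (equal to `0` when `P_U(u) = 0`). -/
def condDistortion (ch : SDMBC X S Y Z) (P : U × X → ℝ) (est : U → Z → S) (u : U) : ℝ :=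
  (∑ ω, Set.indicator {ω : U × X × S × Y × Z | ω.1 = u}
      (fun (u, x, s, y, z) => ch.joint P (u, x, s, y, z) * ch.d s (est u z)) ω) /
    law (ch.joint P) (fun (u, _, _, _, _) => u) u

/-- `∑_{u,x} P_{UX}(u, x) c(u)`. -/
def oneShotDistortion (ch : SDMBC X S Y Z) (P : U × X → ℝ) (est : U → Z → S) : ℝ :=
  ∑ u, ∑ x, P (u, x) * ch.condDistortion P est u

end SingleLetter

end SDMBC

end ISAC

end

set_option linter.unusedSectionVars false

/-! Achievability is superposition coding. Cloud centres drawn from `pU` carry the common message,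
and satellites drawn from the kernel `Q` carry the private one. The sensing receiver decodes the
cloud centre from its own output and applies the one-shot estimator letter by letter to the decoded
centre and that output.

The decoders use likelihood-ratio thresholds instead of typical sets. A Chernoff bound
(`tendsto_sum_likelihoodSet_compl`) shows that the true codeword passes whenever the threshold
exponent is below the relevant information, and a change of measure (`sum_likelihoodSet_le`) makes a
false one pass with probability at most `2 ^ (-(n γ))`. The union bound over wrong clouds at each
receiver and over wrong satellites in the right cloud yields the three rate constraints. One
codebook must serve both error and distortion, so the averaged cost is distortion plus a price times
error probability (`exists_codebook_cost_le`, `exists_code`); letting the price grow slowly in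
`isAchievable_of_lt` controls both. The closed rate region follows by shrinking the rates.

For the cardinality bounds, fix the input marginal. Then `I(X;Y|S)` is fixed, and each of `I(U;Z)`,
`I(X;Y|U,S)` and the least distortion is, up to sign and an additive constant, a sum over `u` of a
continuous positively homogeneous function of the row `P (u, ·)`. The Fenchel–Eggleston theorem
(`exists_combination_of_mem_convexHull_image`) replaces the rows by few new ones with the same sums.
-/

noncomputable section

namespace ISAC

/-! ### Push-forward laws and sums against product measures. -/

section Law

variable {Ω A : Type*} [Fintype Ω]

open Classical in
theorem law_eq_sum_ite (p : Ω → ℝ) (f : Ω → A) (a : A) :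
    law p f a = ∑ ω, if f ω = a then p ω else 0 := by
  simp [law, Set.indicator_apply]

theorem sum_law_mul [Fintype A] (p : Ω → ℝ) (f : Ω → A) (F : A → ℝ) :
    ∑ a, law p f a * F a = ∑ ω, p ω * F (f ω) := by
  classical
  simp only [law_eq_sum_ite, Finset.sum_mul, ite_mul, zero_mul]
  rw [Finset.sum_comm]
  simp

theorem law_nonneg {p : Ω → ℝ} (hp : ∀ ω, 0 ≤ p ω) (f : Ω → A) (a : A) : 0 ≤ law p f a :=
  Finset.sum_nonneg fun ω _ => Set.indicator_nonneg (fun ω _ => hp ω) ω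

theorem law_mem_stdSimplex [Fintype A] {p : Ω → ℝ} (hp : p ∈ stdSimplex ℝ Ω) (f : Ω → A) :
    law p f ∈ stdSimplex ℝ A := by
  refine ⟨law_nonneg hp.1 f, ?_⟩
  have := sum_law_mul p f fun _ => 1
  simpa [hp.2] using this

end Law

section Product

variable {ι A B : Type*} [Fintype ι] [Fintype A] [Fintype B]

theorem sum_pi_prod [DecidableEq ι] (g : ι → A → ℝ) :
    ∑ c : ι → A, ∏ i, g i (c i) = ∏ i, ∑ a, g i a := by
  rw [Finset.prod_univ_sum, Fintype.piFinset_univ]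

theorem prod_mem_stdSimplex [DecidableEq ι] {p : ι → A → ℝ} (hp : ∀ i, p i ∈ stdSimplex ℝ A) :
    (fun c : ι → A => ∏ i, p i (c i)) ∈ stdSimplex ℝ (ι → A) := by
  refine ⟨fun c => Finset.prod_nonneg fun i _ => (hp i).1 _, ?_⟩
  rw [sum_pi_prod]
  simp [(hp _).2]

theorem sum_arrow_prod [DecidableEq ι] (F : (ι → A) → (ι → B) → ℝ) :
    ∑ a, ∑ b, F a b = ∑ c : ι → A × B, F (fun i => (c i).1) (fun i => (c i).2) := by
  rw [← Fintype.sum_prod_type']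
  exact (Fintype.sum_equiv (Equiv.arrowProdEquivProdArrow ι (fun _ => A) (fun _ => B)) _ _
    fun c => rfl).symm

/-- A letterwise image of an i.i.d. sequence is i.i.d. with the image law. This lets each block
event be evaluated under the marginal of the variables it involves. -/
theorem sum_iid_comp [DecidableEq ι] (p : A → ℝ) (g : A → B) (F : (ι → B) → ℝ) :
    ∑ c : ι → A, (∏ i, p (c i)) * F (fun i => g (c i)) =
      ∑ b : ι → B, (∏ i, law p g (b i)) * F b := by
  classical
  have h : ∀ b : ι → B, ∏ i, law p g (b i) =
      law (fun c : ι → A => ∏ i, p (c i)) (fun c i => g (c i)) b := by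
    intro b
    simp only [law_eq_sum_ite]
    rw [← sum_pi_prod (fun i a => if g a = b i then p a else 0)]
    refine Finset.sum_congr rfl fun c _ => ?_
    split_ifs with hc
    · exact Finset.prod_congr rfl fun i _ => by simp [← hc]
    · obtain ⟨i, hi⟩ := Function.ne_iff.1 hc
      exact Finset.prod_eq_zero (Finset.mem_univ i) (if_neg hi)
  simp only [h]
  rw [sum_law_mul]

theorem sum_prod_mul_apply [DecidableEq ι] {p : A → ℝ} (hp : ∑ a, p a = 1) (i : ι) (G : A → ℝ) :
    ∑ c : ι → A, (∏ k, p (c k)) * G (c i) = ∑ a, p a * G a := by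
  have h : ∀ c : ι → A, (∏ k, p (c k)) * G (c i) =
      ∏ k, (p (c k) * if k = i then G (c k) else 1) := by
    intro c
    rw [Finset.prod_mul_distrib, Finset.prod_ite_eq' Finset.univ i fun k => G (c k)]
    simp
  simp only [h]
  rw [sum_pi_prod (fun k a => p a * if k = i then G a else 1), Finset.prod_eq_single i]
  · simp
  · intro k _ hk
    simp [hk, hp]
  · simp

theorem sum_prod_mul_apply₂ [DecidableEq ι] {p : A → ℝ} (hp : ∑ a, p a = 1) {i j : ι} (hij : i ≠ j)
    (G : A → A → ℝ) :
    ∑ c : ι → A, (∏ k, p (c k)) * G (c i) (c j) = ∑ a, ∑ b, p a * p b * G a b := by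
  classical
  -- `G (c i) (c j)` does not factor over coordinates; summing over the value `b` of `c j`, enforced
  -- by an indicator, writes it as a sum of products.
  have h : ∀ c : ι → A, (∏ k, p (c k)) * G (c i) (c j) = ∑ b,
      ∏ k, (p (c k) * if k = i then G (c k) b else if k = j then (if c k = b then 1 else 0) else 1) := by
    intro c
    have h' : ∀ b, ∏ k, (p (c k) * if k = i then G (c k) b else
        if k = j then (if c k = b then 1 else 0) else 1) =
        (∏ k, p (c k)) * (G (c i) b * if c j = b then 1 else 0) := by
      intro b
      rw [Finset.prod_mul_distrib, Finset.prod_eq_mul (f := fun k => if k = i then G (c k) b else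
        if k = j then (if c k = b then (1 : ℝ) else 0) else 1) i j hij]
      · simp [hij.symm]
      · intro k _ hk
        simp [hk.1, hk.2]
      · simp
      · simp
    simp only [h', ← Finset.mul_sum]
    simp
  simp only [h]
  rw [Finset.sum_comm]
  conv_rhs => rw [Finset.sum_comm]
  refine Finset.sum_congr rfl fun b _ => ?_
  rw [sum_pi_prod (fun k a => p a * if k = i then G a b else
    if k = j then (if a = b then 1 else 0) else 1), Finset.prod_eq_mul i j hij]
  · simp [hij.symm, Finset.sum_mul]
    exact Finset.sum_congr rfl fun a _ => by ring
  · intro k _ hk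
    simp [hk.1, hk.2, hp]
  · simp
  · simp

end Product

/-! ### Likelihood-ratio tests: missed detections and false alarms. -/

section LikelihoodRatio

variable {Ω : Type*} [Fintype Ω]

/-- The sequences on which the likelihood ratio of `pⁿ` to `qⁿ` is at least `2 ^ (n γ)`. -/
def likelihoodSet (p q : Ω → ℝ) (γ : ℝ) (n : ℕ) : Set (Fin n → Ω) :=
  {ω | (2 : ℝ) ^ ((n : ℝ) * γ) * ∏ i, q (ω i) ≤ ∏ i, p (ω i)}

/-- Change of measure: on the set, `qⁿ` is at most `2 ^ (-(n γ))` times `pⁿ`, whose total mass is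
one. -/
theorem sum_likelihoodSet_le {p q : Ω → ℝ} (hp : p ∈ stdSimplex ℝ Ω) (γ : ℝ) (n : ℕ) :
    ∑ ω : Fin n → Ω, (∏ i, q (ω i)) * (likelihoodSet p q γ n).indicator 1 ω ≤
      (2 : ℝ) ^ (-((n : ℝ) * γ)) := by
  have h2 : (0 : ℝ) < (2 : ℝ) ^ (-((n : ℝ) * γ)) := by positivity
  have hpn := prod_mem_stdSimplex (ι := Fin n) (p := fun _ => p) fun _ => hp
  calc _ ≤ ∑ ω : Fin n → Ω, (2 : ℝ) ^ (-((n : ℝ) * γ)) * ∏ i, p (ω i) := by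
        refine Finset.sum_le_sum fun ω _ => ?_
        by_cases hω : ω ∈ likelihoodSet p q γ n
        · rw [Set.indicator_of_mem hω, Pi.one_apply, mul_one]
          calc _ = (2 : ℝ) ^ (-((n : ℝ) * γ)) * ((2 : ℝ) ^ ((n : ℝ) * γ) * ∏ i, q (ω i)) := by
                rw [← mul_assoc, ← Real.rpow_add two_pos]; simp
            _ ≤ _ := mul_le_mul_of_nonneg_left hω h2.le
        · rw [Set.indicator_of_notMem hω, mul_zero]
          exact mul_nonneg h2.le (hpn.1 ω)
    _ = _ := by rw [← Finset.mul_sum, hpn.2, mul_one]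

/-- The moment generating function of `-f` equals one at `0` and has derivative `-E f < 0` there. -/
theorem exists_pos_sum_mul_exp_lt_one {p f : Ω → ℝ} (hp : ∑ ω, p ω = 1)
    (hf : 0 < ∑ ω, p ω * f ω) : ∃ t > 0, ∑ ω, p ω * Real.exp (-(t * f ω)) < 1 := by
  have hd : HasDerivAt (fun t : ℝ => ∑ ω, p ω * Real.exp (-(t * f ω)))
      (∑ ω, p ω * (Real.exp (-(0 * f ω)) * -(1 * f ω))) 0 :=
    HasDerivAt.fun_sum fun ω _ => ((((hasDerivAt_id (0 : ℝ)).mul_const (f ω)).neg).exp).const_mul _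
  have hneg : (∑ ω, p ω * (Real.exp (-(0 * f ω)) * -(1 * f ω))) < 0 := by simpa using hf
  have hs := hd.tendsto_slope_zero_right.eventually (gt_mem_nhds hneg)
  obtain ⟨t, ht, ht0⟩ := (hs.and self_mem_nhdsWithin).exists
  refine ⟨t, ht0, ?_⟩
  have ht0' : (0 : ℝ) < t := ht0
  simp only [zero_add, smul_eq_mul, zero_mul, neg_zero, Real.exp_zero, mul_one, hp] at ht
  have := (inv_mul_lt_iff₀ ht0').1 ht
  linarith

/-- Chernoff's bound: the probability is at most the `n`-th power of a single-letter exponential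
moment that is less than one. Absolute continuity keeps the logarithms meaningful on the support of
`p`. -/
theorem tendsto_sum_likelihoodSet_compl {p q : Ω → ℝ} (hp : p ∈ stdSimplex ℝ Ω)
    (hq : ∀ ω, 0 ≤ q ω) (hpq : ∀ ω, q ω = 0 → p ω = 0) {γ : ℝ}
    (hγ : γ < ∑ ω, p ω * Real.logb 2 (p ω / q ω)) :
    Tendsto (fun n => ∑ ω : Fin n → Ω, (∏ i, p (ω i)) * (likelihoodSet p q γ n)ᶜ.indicator 1 ω)
      atTop (𝓝 0) := by
  -- The excess over the threshold in nats; its mean is positive because `γ` lies below the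
  -- divergence.
  set f : Ω → ℝ := fun ω => Real.log (p ω / q ω) - γ * Real.log 2
  have hl2 : 0 < Real.log 2 := Real.log_pos one_lt_two
  have hf : 0 < ∑ ω, p ω * f ω := by
    simp only [f, mul_sub, Finset.sum_sub_distrib, ← Finset.sum_mul, hp.2, one_mul, sub_pos]
    simp only [Real.logb, ← mul_div_assoc, ← Finset.sum_div] at hγ
    rwa [lt_div_iff₀ hl2] at hγ
  obtain ⟨t, ht, ht1⟩ := exists_pos_sum_mul_exp_lt_one hp.2 hf
  have hr0 : 0 ≤ ∑ ω, p ω * Real.exp (-(t * f ω)) :=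
    Finset.sum_nonneg fun ω _ => mul_nonneg (hp.1 ω) (Real.exp_pos _).le
  refine squeeze_zero (fun n => Finset.sum_nonneg fun ω _ => mul_nonneg
    (Finset.prod_nonneg fun i _ => hp.1 _) (Set.indicator_nonneg (fun _ _ => zero_le_one) _))
    (fun n => ?_) (tendsto_pow_atTop_nhds_zero_of_lt_one hr0 ht1)
  have hpow := sum_pi_prod (ι := Fin n) fun _ ω => p ω * Real.exp (-(t * f ω))
  rw [Finset.prod_const, Finset.card_univ, Fintype.card_fin] at hpow
  rw [← hpow]
  refine Finset.sum_le_sum fun ω _ => ?_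
  rw [Finset.prod_mul_distrib]
  by_cases h0 : ∏ i, p (ω i) = 0
  · simp [h0]
  refine mul_le_mul_of_nonneg_left ?_ (Finset.prod_nonneg fun i _ => hp.1 _)
  by_cases hω : ω ∈ likelihoodSet p q γ n
  · rw [Set.indicator_of_notMem (by simpa using hω)]
    exact Finset.prod_nonneg fun i _ => (Real.exp_pos _).le
  rw [Set.indicator_of_mem hω, Pi.one_apply, ← Real.exp_sum, Real.one_le_exp_iff]
  have hpi : ∀ i, 0 < p (ω i) := fun i =>
    (hp.1 _).lt_of_ne' (Finset.prod_ne_zero_iff.1 h0 i (Finset.mem_univ i))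
  have hqi : ∀ i, 0 < q (ω i) := fun i =>
    (hq _).lt_of_ne' fun h => (hpi i).ne' (hpq _ h)
  have hlt : ∏ i, p (ω i) < (2 : ℝ) ^ ((n : ℝ) * γ) * ∏ i, q (ω i) := not_le.1 hω
  have hlog := Real.log_lt_log (Finset.prod_pos fun i _ => hpi i) hlt
  rw [Real.log_mul (by positivity) (Finset.prod_pos fun i _ => hqi i).ne',
    Real.log_prod (fun i _ => (hpi i).ne'), Real.log_prod (fun i _ => (hqi i).ne'),
    Real.log_rpow two_pos] at hlog
  have hsum : ∑ i, f (ω i) = ∑ i, Real.log (p (ω i)) - ∑ i, Real.log (q (ω i)) -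
      n * (γ * Real.log 2) := by
    simp only [f, fun i => Real.log_div (hpi i).ne' (hqi i).ne', Finset.sum_sub_distrib,
      Finset.sum_const, Finset.card_univ, Fintype.card_fin, nsmul_eq_mul]
  rw [Finset.sum_neg_distrib, ← Finset.mul_sum, ← mul_neg]
  refine mul_nonneg ht.le ?_
  rw [hsum]
  linarith

end LikelihoodRatio

/-! ### One-shot random coding with superposition codebooks. -/

section Superposition

variable {U X S Y Z : Type*} [Fintype U] [Fintype X] [Fintype S] [Fintype Y] [Fintype Z]
variable {M₀ M₁ : ℕ}

/-- The law of one cloud of a random superposition codebook: a cloud centre `u ∼ pU` and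
conditionally i.i.d. satellites `∼ Q u`. -/
def cloudPmf (pU : U → ℝ) (Q : U → X → ℝ) (M₁ : ℕ) (a : U × (Fin M₁ → X)) : ℝ :=
  pU a.1 * ∏ j, Q a.1 (a.2 j)

/-- The mean of `G` over a random codebook of `M₀` independent clouds. -/
def codebookMean (pU : U → ℝ) (Q : U → X → ℝ) (G : (Fin M₀ → U × (Fin M₁ → X)) → ℝ) : ℝ :=
  ∑ c, (∏ i, cloudPmf pU Q M₁ (c i)) * G c

variable {pU : U → ℝ} {Q : U → X → ℝ}

theorem cloudPmf_nonneg (hpU : pU ∈ stdSimplex ℝ U) (hQ : ∀ u, Q u ∈ stdSimplex ℝ X)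
    (a : U × (Fin M₁ → X)) : 0 ≤ cloudPmf pU Q M₁ a :=
  mul_nonneg (hpU.1 _) (Finset.prod_nonneg fun _ _ => (hQ _).1 _)

theorem sum_cloudPmf_mul (hQ : ∀ u, Q u ∈ stdSimplex ℝ X) (j : Fin M₁) (H : U → X → ℝ) :
    ∑ a, cloudPmf pU Q M₁ a * H a.1 (a.2 j) = ∑ u, ∑ x, pU u * Q u x * H u x := by
  rw [Fintype.sum_prod_type]
  refine Finset.sum_congr rfl fun u _ => ?_
  simp only [cloudPmf, mul_assoc, ← Finset.mul_sum]
  rw [sum_prod_mul_apply (hQ u).2 j (H u)]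

theorem sum_cloudPmf_mul₂ (hQ : ∀ u, Q u ∈ stdSimplex ℝ X) {j j' : Fin M₁} (hj : j ≠ j')
    (H : U → X → X → ℝ) :
    ∑ a, cloudPmf pU Q M₁ a * H a.1 (a.2 j) (a.2 j') =
      ∑ u, ∑ x, ∑ x', pU u * Q u x * Q u x' * H u x x' := by
  rw [Fintype.sum_prod_type]
  refine Finset.sum_congr rfl fun u _ => ?_
  simp only [cloudPmf, mul_assoc, ← Finset.mul_sum]
  rw [sum_prod_mul_apply₂ (hQ u).2 hj (H u)]
  simp only [mul_assoc, Finset.mul_sum]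

theorem sum_cloudPmf (hpU : pU ∈ stdSimplex ℝ U) (hQ : ∀ u, Q u ∈ stdSimplex ℝ X) :
    ∑ a, cloudPmf pU Q M₁ a = 1 := by
  rw [Fintype.sum_prod_type]
  simp only [cloudPmf, ← Finset.mul_sum]
  have h : ∀ u, ∑ x : Fin M₁ → X, ∏ j, Q u (x j) = 1 := fun u =>
    (prod_mem_stdSimplex fun _ => hQ u).2
  simp [h, hpU.2]

theorem codebookMean_add (G G' : (Fin M₀ → U × (Fin M₁ → X)) → ℝ) :
    codebookMean pU Q (fun c => G c + G' c) = codebookMean pU Q G + codebookMean pU Q G' := by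
  simp only [codebookMean, mul_add, Finset.sum_add_distrib]

theorem codebookMean_const_mul (κ : ℝ) (G : (Fin M₀ → U × (Fin M₁ → X)) → ℝ) :
    codebookMean pU Q (fun c => κ * G c) = κ * codebookMean pU Q G := by
  simp only [codebookMean, Finset.mul_sum, mul_left_comm]

theorem codebookMean_sum {ι : Type*} (s : Finset ι) (G : ι → (Fin M₀ → U × (Fin M₁ → X)) → ℝ) :
    codebookMean pU Q (fun c => ∑ i ∈ s, G i c) = ∑ i ∈ s, codebookMean pU Q (G i) := by
  simp only [codebookMean, Finset.mul_sum]
  rw [Finset.sum_comm]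

theorem codebookMean_mono (hpU : pU ∈ stdSimplex ℝ U) (hQ : ∀ u, Q u ∈ stdSimplex ℝ X)
    {G G' : (Fin M₀ → U × (Fin M₁ → X)) → ℝ} (h : ∀ c, G c ≤ G' c) :
    codebookMean pU Q G ≤ codebookMean pU Q G' :=
  Finset.sum_le_sum fun c _ => mul_le_mul_of_nonneg_left (h c)
    (Finset.prod_nonneg fun _ _ => cloudPmf_nonneg hpU hQ _)

theorem exists_le_codebookMean (hpU : pU ∈ stdSimplex ℝ U) (hQ : ∀ u, Q u ∈ stdSimplex ℝ X)
    (G : (Fin M₀ → U × (Fin M₁ → X)) → ℝ) : ∃ c, G c ≤ codebookMean pU Q G := by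
  by_contra! h
  have hμ : cloudPmf pU Q M₁ ∈ stdSimplex ℝ _ := ⟨cloudPmf_nonneg hpU hQ, sum_cloudPmf hpU hQ⟩
  have hc := prod_mem_stdSimplex (ι := Fin M₀) fun _ => hμ
  refine lt_irrefl (codebookMean pU Q G) ?_
  -- A codebook of positive probability is needed for the averaged inequality to be strict.
  obtain ⟨c, -, hc0⟩ := Finset.exists_ne_zero_of_sum_ne_zero (hc.2.trans_ne one_ne_zero)
  calc codebookMean pU Q G
      = ∑ c : Fin M₀ → U × (Fin M₁ → X),
          (∏ i, cloudPmf pU Q M₁ (c i)) * codebookMean pU Q G := by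
        rw [← Finset.sum_mul, hc.2, one_mul]
    _ < _ := Finset.sum_lt_sum (fun c _ => mul_le_mul_of_nonneg_left (h c).le (hc.1 c))
        ⟨c, Finset.mem_univ c, mul_lt_mul_of_pos_left (h c) ((hc.1 c).lt_of_ne' hc0)⟩

theorem codebookMean_apply (hpU : pU ∈ stdSimplex ℝ U) (hQ : ∀ u, Q u ∈ stdSimplex ℝ X)
    (i : Fin M₀) (j : Fin M₁) (H : U → X → ℝ) :
    codebookMean pU Q (fun c : Fin M₀ → U × (Fin M₁ → X) => H (c i).1 ((c i).2 j)) =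
      ∑ u, ∑ x, pU u * Q u x * H u x := by
  rw [← sum_cloudPmf_mul hQ j H]
  exact sum_prod_mul_apply (sum_cloudPmf hpU hQ) i fun a => H a.1 (a.2 j)

theorem codebookMean_apply_satellites (hpU : pU ∈ stdSimplex ℝ U)
    (hQ : ∀ u, Q u ∈ stdSimplex ℝ X) (i : Fin M₀) {j j' : Fin M₁} (hj : j ≠ j')
    (H : U → X → X → ℝ) :
    codebookMean pU Q
        (fun c : Fin M₀ → U × (Fin M₁ → X) => H (c i).1 ((c i).2 j) ((c i).2 j')) =
      ∑ u, ∑ x, ∑ x', pU u * Q u x * Q u x' * H u x x' := by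
  rw [← sum_cloudPmf_mul₂ hQ hj H]
  exact sum_prod_mul_apply (sum_cloudPmf hpU hQ) i fun a => H a.1 (a.2 j) (a.2 j')

theorem codebookMean_apply_clouds (hpU : pU ∈ stdSimplex ℝ U)
    (hQ : ∀ u, Q u ∈ stdSimplex ℝ X) {i i' : Fin M₀} (hi : i ≠ i') (j j' : Fin M₁)
    (H : U → X → U → X → ℝ) :
    codebookMean pU Q (fun c : Fin M₀ → U × (Fin M₁ → X) =>
        H (c i).1 ((c i).2 j) (c i').1 ((c i').2 j')) =
      ∑ u, ∑ x, ∑ u', ∑ x', pU u * Q u x * (pU u' * Q u' x') * H u x u' x' := by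
  have h := sum_prod_mul_apply₂ (sum_cloudPmf (M₁ := M₁) hpU hQ) hi
    fun a b => H a.1 (a.2 j) b.1 (b.2 j')
  refine h.trans ?_
  have h1 : ∀ a : U × (Fin M₁ → X), ∑ b, cloudPmf pU Q M₁ a * cloudPmf pU Q M₁ b *
      H a.1 (a.2 j) b.1 (b.2 j') =
      cloudPmf pU Q M₁ a * ∑ u', ∑ x', pU u' * Q u' x' * H a.1 (a.2 j) u' x' := by
    intro a
    simp only [mul_assoc, ← Finset.mul_sum]
    rw [sum_cloudPmf_mul hQ j' (H a.1 (a.2 j))]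
    simp only [mul_assoc, ← Finset.mul_sum]
  simp only [h1]
  rw [sum_cloudPmf_mul hQ j fun u x => ∑ u', ∑ x', pU u' * Q u' x' * H u x u' x']
  simp only [mul_assoc, Finset.mul_sum]

/-- The decoders pick an arbitrary passing candidate, so they are right as soon as the true message
is the only one that passes. -/
theorem epsilon_eq_of_unique {ι : Type*} [Nonempty ι] {p : ι → Prop} {w : ι} (hw : p w)
    (h : ∀ w', w' ≠ w → ¬p w') : Classical.epsilon p = w := by
  by_contra hne
  exact h _ hne (Classical.epsilon_spec ⟨w, hw⟩)

variable [NeZero M₀] [NeZero M₁]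

/-- The first decoder of a codebook: some message pair that passes the test `A₁`. -/
def pairDecoder (A₁ : Set (U × X × S × Y)) (c : Fin M₀ → U × (Fin M₁ → X)) (y : Y) (s : S) :
    Fin M₀ × Fin M₁ :=
  Classical.epsilon fun w : Fin M₀ × Fin M₁ => ((c w.1).1, (c w.1).2 w.2, s, y) ∈ A₁

/-- The second decoder of a codebook: some common message that passes the test `A₂`. -/
def commonDecoder (A₂ : Set (U × Z)) (c : Fin M₀ → U × (Fin M₁ → X)) (z : Z) : Fin M₀ :=
  Classical.epsilon fun w : Fin M₀ => ((c w).1, z) ∈ A₂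

/-- The decoding error event given the messages and the outputs. -/
def errorEvent (A₁ : Set (U × X × S × Y)) (A₂ : Set (U × Z)) (c : Fin M₀ → U × (Fin M₁ → X))
    (w₀ : Fin M₀) (w₁ : Fin M₁) : Set (S × Y × Z) :=
  {t | pairDecoder A₁ c t.2.1 t.1 ≠ (w₀, w₁) ∨ commonDecoder A₂ c t.2.2 ≠ w₀}

theorem not_mem_of_indicator_one_lt {α : Type*} {A : Set α} {a : α}
    (h : A.indicator (1 : α → ℝ) a < 1) : a ∉ A := fun ha => by
  simp [ha] at h

theorem indicator_one_nonneg {α : Type*} (A : Set α) (a : α) :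
    0 ≤ A.indicator (1 : α → ℝ) a :=
  Set.indicator_nonneg (fun _ _ => zero_le_one) a

/-- Union bound. Wrong pairs at the first decoder are split according to whether the cloud is right,
because a satellite of the right cloud still depends on the transmitted codeword through the centre.
-/
theorem indicator_errorEvent_le (A₁ : Set (U × X × S × Y)) (A₂ : Set (U × Z))
    (c : Fin M₀ → U × (Fin M₁ → X)) (w₀ : Fin M₀) (w₁ : Fin M₁) (t : S × Y × Z) :
    (errorEvent A₁ A₂ c w₀ w₁).indicator (1 : S × Y × Z → ℝ) t ≤
      A₁ᶜ.indicator 1 ((c w₀).1, (c w₀).2 w₁, t.1, t.2.1) +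
      A₂ᶜ.indicator 1 ((c w₀).1, t.2.2) +
      ∑ w ∈ Finset.univ.erase w₀, A₂.indicator 1 ((c w).1, t.2.2) +
      ∑ w ∈ Finset.univ.erase w₀, ∑ v, A₁.indicator 1 ((c w).1, (c w).2 v, t.1, t.2.1) +
      ∑ v ∈ Finset.univ.erase w₁, A₁.indicator 1 ((c w₀).1, (c w₀).2 v, t.1, t.2.1) := by
  have n1 := indicator_one_nonneg A₁ᶜ ((c w₀).1, (c w₀).2 w₁, t.1, t.2.1)
  have n2 := indicator_one_nonneg A₂ᶜ ((c w₀).1, t.2.2)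
  have n3 : 0 ≤ ∑ w ∈ Finset.univ.erase w₀, A₂.indicator (1 : U × Z → ℝ) ((c w).1, t.2.2) :=
    Finset.sum_nonneg fun w _ => indicator_one_nonneg _ _
  have n4 : 0 ≤ ∑ w ∈ Finset.univ.erase w₀, ∑ v,
      A₁.indicator (1 : U × X × S × Y → ℝ) ((c w).1, (c w).2 v, t.1, t.2.1) :=
    Finset.sum_nonneg fun w _ => Finset.sum_nonneg fun v _ => indicator_one_nonneg _ _
  have n5 : 0 ≤ ∑ v ∈ Finset.univ.erase w₁,
      A₁.indicator (1 : U × X × S × Y → ℝ) ((c w₀).1, (c w₀).2 v, t.1, t.2.1) :=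
    Finset.sum_nonneg fun v _ => indicator_one_nonneg _ _
  by_cases ht : t ∈ errorEvent A₁ A₂ c w₀ w₁
  swap
  · rw [Set.indicator_of_notMem ht]
    positivity
  rw [Set.indicator_of_mem ht, Pi.one_apply]
  -- If the nonnegative sum is below one, every indicator in it vanishes, so the true message passes
  -- both tests and no competitor does.
  by_contra! hlt
  have h1 := not_mem_of_indicator_one_lt (A := A₁ᶜ)
    (a := ((c w₀).1, (c w₀).2 w₁, t.1, t.2.1)) (by linarith)
  have h2 := not_mem_of_indicator_one_lt (A := A₂ᶜ) (a := ((c w₀).1, t.2.2)) (by linarith)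
  have h3 : ∀ w, w ≠ w₀ → ((c w).1, t.2.2) ∉ A₂ := fun w hw =>
    not_mem_of_indicator_one_lt <| lt_of_le_of_lt
      (Finset.single_le_sum (f := fun w => A₂.indicator (1 : U × Z → ℝ) ((c w).1, t.2.2))
        (fun _ _ => indicator_one_nonneg _ _) (Finset.mem_erase.2 ⟨hw, Finset.mem_univ w⟩))
      (by linarith)
  have h4 : ∀ w, w ≠ w₀ → ∀ v, ((c w).1, (c w).2 v, t.1, t.2.1) ∉ A₁ := fun w hw v =>
    not_mem_of_indicator_one_lt <| lt_of_le_of_lt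
      ((Finset.single_le_sum
        (f := fun v => A₁.indicator (1 : U × X × S × Y → ℝ) ((c w).1, (c w).2 v, t.1, t.2.1))
        (fun _ _ => indicator_one_nonneg _ _) (Finset.mem_univ v)).trans
      (Finset.single_le_sum
        (f := fun w => ∑ v, A₁.indicator (1 : U × X × S × Y → ℝ) ((c w).1, (c w).2 v, t.1, t.2.1))
        (fun _ _ => Finset.sum_nonneg fun _ _ => indicator_one_nonneg _ _)
        (Finset.mem_erase.2 ⟨hw, Finset.mem_univ w⟩)))
      (by linarith)
  have h5 : ∀ v, v ≠ w₁ → ((c w₀).1, (c w₀).2 v, t.1, t.2.1) ∉ A₁ := fun v hv =>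
    not_mem_of_indicator_one_lt <| lt_of_le_of_lt
      (Finset.single_le_sum
        (f := fun v => A₁.indicator (1 : U × X × S × Y → ℝ) ((c w₀).1, (c w₀).2 v, t.1, t.2.1))
        (fun _ _ => indicator_one_nonneg _ _) (Finset.mem_erase.2 ⟨hv, Finset.mem_univ v⟩))
      (by linarith)
  rw [Set.notMem_compl_iff] at h1 h2
  refine ht.elim (fun h => h (epsilon_eq_of_unique h1 ?_))
    fun h => h (epsilon_eq_of_unique h2 h3)
  rintro ⟨w, v⟩ hwv
  by_cases hw : w = w₀
  · subst hw
    exact h5 v fun hv => hwv (by rw [hv])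
  · exact h4 w hw v

/-- Random coding bound for superposition codes over a one-shot channel: with a genie-aided cost `f`
and a price `κ` for decoding errors, some codebook does at least as well as the average. -/
theorem exists_codebook_cost_le (hpU : pU ∈ stdSimplex ℝ U) (hQ : ∀ u, Q u ∈ stdSimplex ℝ X)
    {V : X → S × Y × Z → ℝ} (hV : ∀ x t, 0 ≤ V x t)
    (A₁ : Set (U × X × S × Y)) (A₂ : Set (U × Z)) (f : U → S × Y × Z → ℝ) {κ : ℝ} (hκ : 0 ≤ κ) :
    ∃ c : Fin M₀ → U × (Fin M₁ → X),
      ((M₀ : ℝ) * M₁)⁻¹ * ∑ w₀, ∑ w₁, ∑ t, V ((c w₀).2 w₁) t *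
        (f (c w₀).1 t + κ * (errorEvent A₁ A₂ c w₀ w₁).indicator 1 t) ≤
      ∑ u, ∑ x, pU u * Q u x * ∑ t, V x t * f u t +
      κ * (∑ u, ∑ x, pU u * Q u x * ∑ t, V x t * A₁ᶜ.indicator 1 (u, x, t.1, t.2.1) +
        ∑ u, ∑ x, pU u * Q u x * ∑ t, V x t * A₂ᶜ.indicator 1 (u, t.2.2) +
        ((M₀ : ℝ) - 1) * ∑ u, ∑ x, ∑ u', ∑ x', pU u * Q u x * (pU u' * Q u' x') *
          ∑ t, V x t * A₂.indicator 1 (u', t.2.2) +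
        ((M₀ : ℝ) - 1) * M₁ * ∑ u, ∑ x, ∑ u', ∑ x', pU u * Q u x * (pU u' * Q u' x') *
          ∑ t, V x t * A₁.indicator 1 (u', x', t.1, t.2.1) +
        ((M₁ : ℝ) - 1) * ∑ u, ∑ x, ∑ x', pU u * Q u x * Q u x' *
          ∑ t, V x t * A₁.indicator 1 (u, x', t.1, t.2.1)) := by
  obtain ⟨c, hc⟩ := exists_le_codebookMean hpU hQ fun c : Fin M₀ → U × (Fin M₁ → X) =>
    ((M₀ : ℝ) * M₁)⁻¹ * ∑ w₀, ∑ w₁, ∑ t, V ((c w₀).2 w₁) t *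
        (f (c w₀).1 t + κ * (errorEvent A₁ A₂ c w₀ w₁).indicator 1 t)
  refine ⟨c, hc.trans ?_⟩
  rw [codebookMean_const_mul, codebookMean_sum]
  rw [Finset.sum_congr rfl fun w₀ _ => codebookMean_sum (Finset.univ : Finset (Fin M₁)) _]
  have hM₀ : (0 : ℝ) < M₀ := Nat.cast_pos.2 (NeZero.pos M₀)
  have hM₁ : (0 : ℝ) < M₁ := Nat.cast_pos.2 (NeZero.pos M₁)
  rw [inv_mul_le_iff₀ (by positivity)]
  set R := ∑ u, ∑ x, pU u * Q u x * ∑ t, V x t * f u t + κ * _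
  -- The clouds are identically distributed and so are the satellites, so one bound serves all
  -- message pairs.
  suffices h : ∀ (w₀ : Fin M₀) (w₁ : Fin M₁), codebookMean pU Q
      (fun c : Fin M₀ → U × (Fin M₁ → X) => ∑ t, V ((c w₀).2 w₁) t *
        (f (c w₀).1 t + κ * (errorEvent A₁ A₂ c w₀ w₁).indicator 1 t)) ≤ R by
    refine (Finset.sum_le_sum fun w₀ _ => Finset.sum_le_sum fun w₁ _ => h w₀ w₁).trans ?_
    simp [mul_assoc]
  intro w₀ w₁
  have hle : ∀ c : Fin M₀ → U × (Fin M₁ → X), ∑ t, V ((c w₀).2 w₁) t *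
        (f (c w₀).1 t + κ * (errorEvent A₁ A₂ c w₀ w₁).indicator 1 t) ≤
      ∑ t, V ((c w₀).2 w₁) t * f (c w₀).1 t + κ * (
        ∑ t, V ((c w₀).2 w₁) t * A₁ᶜ.indicator 1 ((c w₀).1, (c w₀).2 w₁, t.1, t.2.1) +
        ∑ t, V ((c w₀).2 w₁) t * A₂ᶜ.indicator 1 ((c w₀).1, t.2.2) +
        ∑ w ∈ Finset.univ.erase w₀,
          ∑ t, V ((c w₀).2 w₁) t * A₂.indicator 1 ((c w).1, t.2.2) +
        ∑ w ∈ Finset.univ.erase w₀, ∑ v,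
          ∑ t, V ((c w₀).2 w₁) t * A₁.indicator 1 ((c w).1, (c w).2 v, t.1, t.2.1) +
        ∑ v ∈ Finset.univ.erase w₁,
          ∑ t, V ((c w₀).2 w₁) t * A₁.indicator 1 ((c w₀).1, (c w₀).2 v, t.1, t.2.1)) := by
    intro c
    have comm : ∀ {ι : Type} (s : Finset ι) (g : ι → S × Y × Z → ℝ),
        ∑ i ∈ s, ∑ t, V ((c w₀).2 w₁) t * g i t = ∑ t, V ((c w₀).2 w₁) t * ∑ i ∈ s, g i t := by
      intro ι s g
      rw [Finset.sum_comm]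
      simp only [Finset.mul_sum]
    rw [comm, Finset.sum_congr rfl fun w _ => comm (Finset.univ : Finset (Fin M₁)) _, comm, comm,
      ← Finset.sum_add_distrib, ← Finset.sum_add_distrib, ← Finset.sum_add_distrib,
      ← Finset.sum_add_distrib, Finset.mul_sum, ← Finset.sum_add_distrib]
    refine Finset.sum_le_sum fun t _ => ?_
    have := mul_le_mul_of_nonneg_left (mul_le_mul_of_nonneg_left
      (indicator_errorEvent_le A₁ A₂ c w₀ w₁ t) hκ) (hV ((c w₀).2 w₁) t)
    linarith
  refine (codebookMean_mono hpU hQ hle).trans (le_of_eq ?_)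
  rw [codebookMean_add, codebookMean_const_mul, codebookMean_add, codebookMean_add,
    codebookMean_add, codebookMean_add, codebookMean_sum (Finset.univ.erase w₀), codebookMean_sum (Finset.univ.erase w₀),
    codebookMean_sum (Finset.univ.erase w₁)]
  rw [Finset.sum_congr (g := fun w => ∑ v : Fin M₁, codebookMean pU Q fun c =>
    ∑ t, V ((c w₀).2 w₁) t * A₁.indicator 1 ((c w).1, (c w).2 v, t.1, t.2.1)) rfl
    fun w _ => codebookMean_sum (Finset.univ : Finset (Fin M₁)) _]
  congr 1
  · exact codebookMean_apply hpU hQ w₀ w₁ fun u x => ∑ t, V x t * f u t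
  congr 1
  congr 1
  swap
  · rw [Finset.sum_congr rfl fun v hv => codebookMean_apply_satellites hpU hQ w₀
      (Finset.ne_of_mem_erase hv).symm
      fun u x x' => ∑ t, V x t * A₁.indicator 1 (u, x', t.1, t.2.1)]
    simp [NeZero.one_le]
  congr 1
  swap
  · rw [Finset.sum_congr rfl fun w hw => Finset.sum_congr rfl fun v _ =>
      codebookMean_apply_clouds hpU hQ (Finset.ne_of_mem_erase hw).symm w₁ v
      fun u x u' x' => ∑ t, V x t * A₁.indicator 1 (u', x', t.1, t.2.1)]
    simp [NeZero.one_le, mul_assoc]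
  congr 1
  swap
  -- This test sees only the wrong centre; `w₁` is a dummy satellite index in the wrong cloud.
  · rw [Finset.sum_congr rfl fun w hw =>
      codebookMean_apply_clouds hpU hQ (Finset.ne_of_mem_erase hw).symm w₁ w₁
      fun u x u' x' => ∑ t, V x t * A₂.indicator 1 (u', t.2.2)]
    simp [NeZero.one_le]
  congr 1
  · exact codebookMean_apply hpU hQ w₀ w₁
      fun u x => ∑ t, V x t * A₁ᶜ.indicator 1 (u, x, t.1, t.2.1)
  · exact codebookMean_apply hpU hQ w₀ w₁
      fun u x => ∑ t, V x t * A₂ᶜ.indicator 1 (u, t.2.2)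

end Superposition

/-- The decidability instance may vary with the index, so the lemma applies whichever instance each
summand carries. -/
theorem sum_ite_zero_irrel {ι : Type*} (s : Finset ι) (p : Prop) (h : ι → Decidable p)
    [Decidable p] (f : ι → ℝ) :
    ∑ i ∈ s, @ite ℝ p (h i) (f i) 0 = if p then ∑ i ∈ s, f i else 0 := by
  by_cases hp : p <;> simp [hp]

/-! ### Marginals of the single-letter law and formulas for the informations. -/

namespace SDMBC

variable {U X S Y Z : Type*} [Fintype U] [Fintype X] [Fintype S] [Fintype Y] [Fintype Z]
variable (ch : SDMBC X S Y Z) (P : U × X → ℝ)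

/-- The channel from the input to the state and both outputs. -/
def outAll (x : X) (t : S × Y × Z) : ℝ := ch.PS t.1 * ch.W x t.1 (t.2.1, t.2.2)

/-- The channel from the input to the state and the output of the communication receiver. -/
def outSY (x : X) (t : S × Y) : ℝ := ∑ z, ch.PS t.1 * ch.W x t.1 (t.2, z)

/-- The channel from the input to the output of the sensing receiver. -/
def outZ (x : X) (z : Z) : ℝ := ∑ s, ∑ y, ch.PS s * ch.W x s (y, z)

theorem outAll_mem (x : X) : ch.outAll x ∈ stdSimplex ℝ (S × Y × Z) := by
  refine ⟨fun t => mul_nonneg (ch.PS_mem.1 _) ((ch.W_mem _ _).1 _), ?_⟩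
  have h : ∀ s, ∑ y, ∑ z, ch.W x s (y, z) = 1 := fun s => by
    rw [← Fintype.sum_prod_type']; exact (ch.W_mem x s).2
  simp only [outAll, Fintype.sum_prod_type, ← Finset.mul_sum, h, mul_one, ch.PS_mem.2]

theorem outSY_mem (x : X) : ch.outSY x ∈ stdSimplex ℝ (S × Y) := by
  refine ⟨fun t => Finset.sum_nonneg fun z _ => (ch.outAll_mem x).1 (t.1, t.2, z), ?_⟩
  have := (ch.outAll_mem x).2
  simpa only [outSY, outAll, Fintype.sum_prod_type] using this

theorem outZ_mem (x : X) : ch.outZ x ∈ stdSimplex ℝ Z := by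
  refine ⟨fun z => Finset.sum_nonneg fun s _ => Finset.sum_nonneg fun y _ =>
    (ch.outAll_mem x).1 (s, y, z), ?_⟩
  have := (ch.outAll_mem x).2
  simp only [outAll, Fintype.sum_prod_type] at this
  simp only [outZ]
  rw [Finset.sum_comm, ← this]
  exact Finset.sum_congr rfl fun s _ => Finset.sum_comm

theorem joint_mem {P : U × X → ℝ} (hP : P ∈ stdSimplex ℝ (U × X)) :
    ch.joint P ∈ stdSimplex ℝ (U × X × S × Y × Z) := by
  have hj : ∀ u x t, ch.joint P (u, x, t) = P (u, x) * ch.outAll x t := fun u x t =>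
    mul_assoc _ _ _
  refine ⟨fun ⟨u, x, t⟩ => hj u x t ▸ mul_nonneg (hP.1 _) ((ch.outAll_mem x).1 t), ?_⟩
  rw [Fintype.sum_prod_type]
  simp only [Fintype.sum_prod_type (α₁ := X), hj, ← Finset.mul_sum, (ch.outAll_mem _).2, mul_one]
  rw [← Fintype.sum_prod_type']
  exact hP.2

theorem law_U (u : U) : law (ch.joint P) (fun (u, _, _, _, _) => u) u = ∑ x, P (u, x) := by
  classical
  have h := fun x => (ch.outAll_mem x).2
  simp only [outAll, Fintype.sum_prod_type] at h
  simp only [law_eq_sum_ite, Fintype.sum_prod_type, joint,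
    sum_ite_zero_irrel, Finset.sum_ite_eq', Finset.mem_univ, if_true]
  simp [mul_assoc, ← Finset.mul_sum]
  simp [Finset.mul_sum, h]

theorem law_Z (z : Z) :
    law (ch.joint P) (fun (_, _, _, _, z) => z) z = ∑ u, ∑ x, P (u, x) * ch.outZ x z := by
  classical
  simp only [law_eq_sum_ite, Fintype.sum_prod_type, joint,
    Finset.sum_ite_eq', Finset.mem_univ, if_true]
  simp [outZ, mul_assoc, ← Finset.mul_sum]

theorem law_UZ (u : U) (z : Z) : law (ch.joint P) (fun ω => (ω.1, ω.2.2.2.2)) (u, z) =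
    ∑ x, P (u, x) * ch.outZ x z := by
  classical
  simp only [law_eq_sum_ite, Fintype.sum_prod_type, joint, Prod.mk.injEq, ite_and,
    sum_ite_zero_irrel, Finset.sum_ite_eq', Finset.mem_univ, if_true]
  simp [outZ, mul_assoc, ← Finset.mul_sum]

theorem law_UXSY (u : U) (x : X) (s : S) (y : Y) :
    law (ch.joint P) (fun ω => (ω.1, ω.2.1, ω.2.2.1, ω.2.2.2.1)) (u, x, s, y) =
      P (u, x) * ch.outSY x (s, y) := by
  classical
  simp only [law_eq_sum_ite, Fintype.sum_prod_type, joint, Prod.mk.injEq, ite_and,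
    sum_ite_zero_irrel, Finset.sum_ite_eq', Finset.mem_univ, if_true]
  simp [outSY, mul_assoc, ← Finset.mul_sum]

theorem law_XYUS (u : U) (x : X) (s : S) (y : Y) :
    law (ch.joint P) (fun ω => (ω.2.1, ω.2.2.2.1, ω.1, ω.2.2.1)) (x, y, u, s) =
      P (u, x) * ch.outSY x (s, y) := by
  classical
  simp only [law_eq_sum_ite, Fintype.sum_prod_type, joint, Prod.mk.injEq, ite_and,
    sum_ite_zero_irrel, Finset.sum_ite_eq', Finset.mem_univ, if_true]
  simp [outSY, mul_assoc, ← Finset.mul_sum]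

theorem law_XYS (x : X) (s : S) (y : Y) :
    law (ch.joint P) (fun ω => (ω.2.1, ω.2.2.2.1, ω.2.2.1)) (x, y, s) =
      (∑ u, P (u, x)) * ch.outSY x (s, y) := by
  classical
  simp only [law_eq_sum_ite, Fintype.sum_prod_type, joint, Prod.mk.injEq, ite_and,
    sum_ite_zero_irrel, Finset.sum_ite_eq', Finset.mem_univ, if_true]
  simp [outSY, mul_assoc, ← Finset.mul_sum, Finset.sum_mul]

theorem law_YUS (u : U) (s : S) (y : Y) :
    law (ch.joint P) (fun ω => (ω.2.2.2.1, ω.1, ω.2.2.1)) (y, u, s) =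
      ∑ x, P (u, x) * ch.outSY x (s, y) := by
  classical
  simp only [law_eq_sum_ite, Fintype.sum_prod_type, joint, Prod.mk.injEq, ite_and,
    sum_ite_zero_irrel, Finset.sum_ite_eq', Finset.mem_univ, if_true]
  simp [outSY, mul_assoc, ← Finset.mul_sum]

theorem law_YS (s : S) (y : Y) :
    law (ch.joint P) (fun ω => (ω.2.2.2.1, ω.2.2.1)) (y, s) =
      ∑ u, ∑ x, P (u, x) * ch.outSY x (s, y) := by
  classical
  simp only [law_eq_sum_ite, Fintype.sum_prod_type, joint, Prod.mk.injEq, ite_and,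
    sum_ite_zero_irrel, Finset.sum_ite_eq', Finset.mem_univ, if_true]
  simp [outSY, mul_assoc, ← Finset.mul_sum]

theorem sum_sum_W (x : X) (s : S) : ∑ y, ∑ z, ch.W x s (y, z) = 1 := by
  rw [← Fintype.sum_prod_type']; exact (ch.W_mem x s).2

theorem law_US (u : U) (s : S) :
    law (ch.joint P) (fun ω => (ω.1, ω.2.2.1)) (u, s) = (∑ x, P (u, x)) * ch.PS s := by
  classical
  simp only [law_eq_sum_ite, Fintype.sum_prod_type, joint, Prod.mk.injEq, ite_and,
    sum_ite_zero_irrel, Finset.sum_ite_eq', Finset.mem_univ, if_true]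
  simp [mul_assoc, ← Finset.mul_sum, sum_sum_W, Finset.sum_mul]

theorem law_XUS (x : X) (u : U) (s : S) :
    law (ch.joint P) (fun ω => (ω.2.1, ω.1, ω.2.2.1)) (x, u, s) = P (u, x) * ch.PS s := by
  classical
  simp only [law_eq_sum_ite, Fintype.sum_prod_type, joint, Prod.mk.injEq, ite_and,
    sum_ite_zero_irrel, Finset.sum_ite_eq', Finset.mem_univ, if_true]
  simp [mul_assoc, ← Finset.mul_sum, sum_sum_W]

theorem law_XS (x : X) (s : S) :
    law (ch.joint P) (fun ω => (ω.2.1, ω.2.2.1)) (x, s) = (∑ u, P (u, x)) * ch.PS s := by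
  classical
  simp only [law_eq_sum_ite, Fintype.sum_prod_type, joint, Prod.mk.injEq, ite_and,
    sum_ite_zero_irrel, Finset.sum_ite_eq', Finset.mem_univ, if_true]
  simp [mul_assoc, ← Finset.mul_sum, sum_sum_W, Finset.sum_mul]

theorem law_S {P : U × X → ℝ} (hP : ∑ a, P a = 1) (s : S) :
    law (ch.joint P) (fun ω => ω.2.2.1) s = ch.PS s := by
  classical
  rw [Fintype.sum_prod_type] at hP
  simp only [law_eq_sum_ite, Fintype.sum_prod_type, joint,
    sum_ite_zero_irrel, Finset.sum_ite_eq', Finset.mem_univ, if_true]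
  simp [mul_assoc, ← Finset.mul_sum, sum_sum_W, ← Finset.sum_mul, hP]

theorem infoUZ_eq : ch.infoUZ P = ∑ u, ∑ z, (∑ x, P (u, x) * ch.outZ x z) *
    Real.logb 2 ((∑ x, P (u, x) * ch.outZ x z) /
      ((∑ x, P (u, x)) * ∑ u', ∑ x, P (u', x) * ch.outZ x z)) := by
  simp only [infoUZ, mutualInfo, law_U, law_Z]
  simp only [law_UZ ch P]

theorem PS_ne_zero {x : X} {s : S} {y : Y} (h : ch.outSY x (s, y) ≠ 0) : ch.PS s ≠ 0 := by
  rintro h0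
  simp [outSY, h0] at h

/-- The state is independent of `(U, X)`, so `P_S` cancels in the ratio and `I(X;Y|U,S) =
I(X;S,Y|U)`: the state becomes part of the output of the first receiver. -/
theorem infoXYgivenUS_eq : ch.infoXYgivenUS P =
    ∑ u, ∑ x, ∑ t, P (u, x) * ch.outSY x t *
      Real.logb 2 (ch.outSY x t * (∑ x', P (u, x')) / ∑ x', P (u, x') * ch.outSY x' t) := by
  have h : ch.infoXYgivenUS P = ∑ x, ∑ y, ∑ c : U × S, P (c.1, x) * ch.outSY x (c.2, y) *
      Real.logb 2 (P (c.1, x) * ch.outSY x (c.2, y) * ((∑ x', P (c.1, x')) * ch.PS c.2) /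
        (P (c.1, x) * ch.PS c.2 * ∑ x', P (c.1, x') * ch.outSY x' (c.2, y))) := by
    rw [← Finset.sum_congr rfl fun x _ => Finset.sum_congr rfl fun y _ =>
      Finset.sum_congr rfl fun c _ => by rw [← law_XYUS, ← law_US, ← law_XUS, ← law_YUS]]
    rfl
  rw [h, Finset.sum_congr rfl fun x _ => Finset.sum_comm, Finset.sum_comm, Fintype.sum_prod_type]
  refine Finset.sum_congr rfl fun u _ => ?_
  rw [Finset.sum_comm]
  refine Finset.sum_congr rfl fun x _ => ?_
  rw [Fintype.sum_prod_type]
  refine Finset.sum_congr rfl fun s _ => Finset.sum_congr rfl fun y _ => ?_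
  by_cases h0 : P (u, x) * ch.outSY x (s, y) = 0
  · simp [h0]
  have hPS := ch.PS_ne_zero (right_ne_zero_of_mul h0)
  congr 2
  rw [show P (u, x) * ch.outSY x (s, y) * ((∑ x', P (u, x')) * ch.PS s) =
    P (u, x) * ch.PS s * (ch.outSY x (s, y) * ∑ x', P (u, x')) by ring]
  exact mul_div_mul_left _ _ (mul_ne_zero (left_ne_zero_of_mul h0) hPS)

/-- Likewise `I(X;Y|S) = I(X;S,Y)`, again because `P_S` cancels. -/
theorem infoXYgivenS_eq {P : U × X → ℝ} (hP : ∑ a, P a = 1) : ch.infoXYgivenS P =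
    ∑ x, ∑ t, (∑ u, P (u, x)) * ch.outSY x t *
      Real.logb 2 (ch.outSY x t / ∑ u, ∑ x', P (u, x') * ch.outSY x' t) := by
  have h : ch.infoXYgivenS P = ∑ x, ∑ y, ∑ s, (∑ u, P (u, x)) * ch.outSY x (s, y) *
      Real.logb 2 ((∑ u, P (u, x)) * ch.outSY x (s, y) * ch.PS s /
        ((∑ u, P (u, x)) * ch.PS s * ∑ u, ∑ x', P (u, x') * ch.outSY x' (s, y))) := by
    rw [← Finset.sum_congr rfl fun x _ => Finset.sum_congr rfl fun y _ =>
      Finset.sum_congr rfl fun s _ => by rw [← law_XYS, ← law_XS, ← law_YS, ← law_S ch hP]]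
    rfl
  rw [h]
  refine Finset.sum_congr rfl fun x _ => ?_
  rw [Finset.sum_comm, Fintype.sum_prod_type]
  refine Finset.sum_congr rfl fun s _ => Finset.sum_congr rfl fun y _ => ?_
  by_cases h0 : (∑ u, P (u, x)) * ch.outSY x (s, y) = 0
  · simp [h0]
  have hPS := ch.PS_ne_zero (right_ne_zero_of_mul h0)
  congr 2
  rw [show (∑ u, P (u, x)) * ch.outSY x (s, y) * ch.PS s =
    (∑ u, P (u, x)) * ch.PS s * ch.outSY x (s, y) by ring]
  exact mul_div_mul_left _ _ (mul_ne_zero (left_ne_zero_of_mul h0) hPS)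

end SDMBC

/-! ### Passing from single letters to blocks. -/

section Reindex

variable {ι A B C D E : Type*} [Fintype ι] [DecidableEq ι]
variable [Fintype A] [Fintype B] [Fintype C] [Fintype D] [Fintype E]

theorem sum_arrow_prod₃ (F : (ι → A) → (ι → B) → (ι → C) → ℝ) :
    ∑ a, ∑ b, ∑ c, F a b c = ∑ ω : ι → A × B × C,
      F (fun i => (ω i).1) (fun i => (ω i).2.1) (fun i => (ω i).2.2) := by
  rw [← sum_arrow_prod fun a (r : ι → B × C) => F a (fun i => (r i).1) (fun i => (r i).2)]
  exact Finset.sum_congr rfl fun a _ => sum_arrow_prod _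

theorem sum_arrow_prod₄ (F : (ι → A) → (ι → B) → (ι → C) → (ι → D) → ℝ) :
    ∑ a, ∑ b, ∑ c, ∑ d, F a b c d = ∑ ω : ι → A × B × C × D,
      F (fun i => (ω i).1) (fun i => (ω i).2.1) (fun i => (ω i).2.2.1)
        (fun i => (ω i).2.2.2) := by
  rw [← sum_arrow_prod fun a (r : ι → B × C × D) =>
    F a (fun i => (r i).1) (fun i => (r i).2.1) (fun i => (r i).2.2)]
  exact Finset.sum_congr rfl fun a _ => sum_arrow_prod₃ _

theorem sum_arrow_prod₅ (F : (ι → A) → (ι → B) → (ι → C) → (ι → D) → (ι → E) → ℝ) :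
    ∑ a, ∑ b, ∑ c, ∑ d, ∑ e, F a b c d e = ∑ ω : ι → A × B × C × D × E,
      F (fun i => (ω i).1) (fun i => (ω i).2.1) (fun i => (ω i).2.2.1)
        (fun i => (ω i).2.2.2.1) (fun i => (ω i).2.2.2.2) := by
  rw [← sum_arrow_prod fun a (r : ι → B × C × D × E) =>
    F a (fun i => (r i).1) (fun i => (r i).2.1) (fun i => (r i).2.2.1) (fun i => (r i).2.2.2)]
  exact Finset.sum_congr rfl fun a _ => sum_arrow_prod₄ _

theorem sum_prod_arrow₃ (G : (ι → A) × (ι → B) × (ι → C) → ℝ) :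
    ∑ t, G t = ∑ τ : ι → A × B × C,
      G (fun i => (τ i).1, fun i => (τ i).2.1, fun i => (τ i).2.2) := by
  rw [← sum_arrow_prod₃ fun a b c => G (a, b, c)]
  simp only [Fintype.sum_prod_type]

end Reindex

theorem indicator_compl_inter_le {α : Type*} (A B : Set α) (a : α) :
    (A ∩ B)ᶜ.indicator (1 : α → ℝ) a ≤ Aᶜ.indicator 1 a + Bᶜ.indicator 1 a := by
  classical
  by_cases hA : a ∈ A <;> by_cases hB : a ∈ B <;> simp [hA, hB]

theorem sum_prod_mul_mean {A : Type*} [Fintype A] {p : A → ℝ} (hp : p ∈ stdSimplex ℝ A)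
    {g : A → ℝ} (hg : ∀ a, 0 ≤ g a) (n : ℕ) :
    ∑ ω : Fin n → A, (∏ i, p (ω i)) * ((1 / (n : ℝ)) * ∑ i, g (ω i)) ≤ ∑ a, p a * g a := by
  have h0 : 0 ≤ ∑ a, p a * g a := Finset.sum_nonneg fun a _ => mul_nonneg (hp.1 a) (hg a)
  simp only [mul_left_comm _ (1 / (n : ℝ)), ← Finset.mul_sum]
  simp only [Finset.mul_sum _ _ (∏ i, p _)]
  rw [Finset.sum_comm]
  simp only [sum_prod_mul_apply hp.2, Finset.sum_const, Finset.card_univ, Fintype.card_fin,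
    nsmul_eq_mul]
  -- At `n = 0` the average is `0`; this case is why the statement is an inequality.
  rcases Nat.eq_zero_or_pos n with rfl | hn
  · simpa using h0
  · have : (0 : ℝ) < n := Nat.cast_pos.2 hn
    field_simp
    exact le_rfl

namespace SDMBC

variable {U X S Y Z : Type*} [Fintype U] [Fintype X] [Fintype S] [Fintype Y] [Fintype Z]
variable (ch : SDMBC X S Y Z)

/-- The joint law of the auxiliary variable and the input, from a marginal and a kernel. -/
def inputPmf (pU : U → ℝ) (Q : U → X → ℝ) (a : U × X) : ℝ := pU a.1 * Q a.1 a.2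

/-- The joint law when a second satellite is drawn for the same cloud centre. -/
def satellitePmf (pU : U → ℝ) (Q : U → X → ℝ) (ω : U × X × X × S × Y × Z) : ℝ :=
  pU ω.1 * Q ω.1 ω.2.1 * Q ω.1 ω.2.2.1 * ch.outAll ω.2.1 ω.2.2.2

/-- The joint law when a second, independent cloud centre with a satellite is drawn. -/
def cloudPairPmf (pU : U → ℝ) (Q : U → X → ℝ) (ω : U × X × U × X × S × Y × Z) : ℝ :=
  pU ω.1 * Q ω.1 ω.2.1 * (pU ω.2.2.1 * Q ω.2.2.1 ω.2.2.2.1) * ch.outAll ω.2.1 ω.2.2.2.2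

/-- The joint law of `(U, X, S, Y)`. -/
def lawUXSY (P : U × X → ℝ) (b : U × X × S × Y) : ℝ := P (b.1, b.2.1) * ch.outSY b.2.1 b.2.2

/-- The product of the laws of `(U, X)` and `(S, Y)`. -/
def lawCloud (P : U × X → ℝ) (b : U × X × S × Y) : ℝ :=
  P (b.1, b.2.1) * ∑ u, ∑ x, P (u, x) * ch.outSY x b.2.2

/-- The law of `(U, X, S, Y)` that makes `X` and `(S, Y)` conditionally independent given `U`. -/
def lawSatellite (pU : U → ℝ) (Q : U → X → ℝ) (b : U × X × S × Y) : ℝ :=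
  pU b.1 * Q b.1 b.2.1 * ∑ x, Q b.1 x * ch.outSY x b.2.2

/-- The joint law of `(U, Z)`. -/
def lawUZ (P : U × X → ℝ) (b : U × Z) : ℝ := ∑ x, P (b.1, x) * ch.outZ x b.2

/-- The product of the laws of `U` and `Z`. -/
def lawUxZ (P : U × X → ℝ) (b : U × Z) : ℝ :=
  (∑ x, P (b.1, x)) * ∑ u, ∑ x, P (u, x) * ch.outZ x b.2

variable {pU : U → ℝ} {Q : U → X → ℝ}

theorem inputPmf_mem (hpU : pU ∈ stdSimplex ℝ U) (hQ : ∀ u, Q u ∈ stdSimplex ℝ X) :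
    inputPmf pU Q ∈ stdSimplex ℝ (U × X) := by
  refine ⟨fun a => mul_nonneg (hpU.1 _) ((hQ _).1 _), ?_⟩
  simp only [inputPmf, Fintype.sum_prod_type, ← Finset.mul_sum, (hQ _).2, mul_one, hpU.2]

theorem sum_inputPmf (hQ : ∀ u, Q u ∈ stdSimplex ℝ X) (u : U) :
    ∑ x, inputPmf pU Q (u, x) = pU u := by
  simp only [inputPmf, ← Finset.mul_sum, (hQ _).2, mul_one]

theorem law_joint_UXSY (P : U × X → ℝ) :
    law (ch.joint P) (fun ω => (ω.1, ω.2.1, ω.2.2.1, ω.2.2.2.1)) = ch.lawUXSY P :=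
  funext fun ⟨_, _, _, _⟩ => ch.law_UXSY P _ _ _ _

theorem law_joint_UZ (P : U × X → ℝ) :
    law (ch.joint P) (fun ω => (ω.1, ω.2.2.2.2)) = ch.lawUZ P :=
  funext fun ⟨_, _⟩ => ch.law_UZ P _ _

/-- A wrong satellite in the right cloud is conditionally independent of the output given the
centre. -/
theorem law_satellitePmf :
    law (ch.satellitePmf pU Q) (fun ω => (ω.1, ω.2.2.1, ω.2.2.2.1, ω.2.2.2.2.1)) =
      ch.lawSatellite pU Q := by
  classical
  ext ⟨u, x, s, y⟩
  simp only [law_eq_sum_ite, Fintype.sum_prod_type, satellitePmf, Prod.mk.injEq, ite_and]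
  simp only [sum_ite_zero_irrel]
  simp only [Finset.sum_ite_eq', Finset.mem_univ, if_true]
  simp only [lawSatellite, outSY, outAll, mul_assoc, Finset.mul_sum]
  refine Finset.sum_congr rfl fun x' _ => Finset.sum_congr rfl fun z _ => ?_
  ring

/-- A codeword from a wrong cloud is independent of the output. -/
theorem law_cloudPairPmf :
    law (ch.cloudPairPmf pU Q) (fun ω => (ω.2.2.1, ω.2.2.2.1, ω.2.2.2.2.1, ω.2.2.2.2.2.1)) =
      ch.lawCloud (inputPmf pU Q) := by
  classical
  ext ⟨u, x, s, y⟩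
  simp only [law_eq_sum_ite, Fintype.sum_prod_type, cloudPairPmf, Prod.mk.injEq, ite_and]
  simp only [sum_ite_zero_irrel]
  simp only [Finset.sum_ite_eq', Finset.mem_univ, if_true]
  simp only [lawCloud, inputPmf, outSY, outAll, mul_assoc, Finset.mul_sum]
  refine Finset.sum_congr rfl fun u' _ => Finset.sum_congr rfl fun x' _ =>
    Finset.sum_congr rfl fun z _ => ?_
  ring

theorem law_cloudPairPmf_UZ (hQ : ∀ u, Q u ∈ stdSimplex ℝ X) :
    law (ch.cloudPairPmf pU Q) (fun ω => (ω.2.2.1, ω.2.2.2.2.2.2)) =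
      ch.lawUxZ (inputPmf pU Q) := by
  classical
  ext ⟨u, z⟩
  simp only [law_eq_sum_ite, Fintype.sum_prod_type, cloudPairPmf, Prod.mk.injEq, ite_and]
  simp only [sum_ite_zero_irrel]
  simp only [Finset.sum_ite_eq', Finset.mem_univ, if_true]
  simp only [lawUxZ, sum_inputPmf hQ]
  simp only [inputPmf, outZ, outAll, Finset.mul_sum]
  refine Finset.sum_congr rfl fun u' _ => Finset.sum_congr rfl fun x' _ => ?_
  rw [Finset.sum_comm]
  refine Finset.sum_congr rfl fun s _ => ?_
  rw [Finset.sum_comm]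
  refine Finset.sum_congr rfl fun y _ => ?_
  rw [← Finset.sum_mul, ← Finset.mul_sum, ← Finset.mul_sum, (hQ u).2]
  ring

/-- The product channel. -/
def outAllN (n : ℕ) (x : Fin n → X) (t : (Fin n → S) × (Fin n → Y) × (Fin n → Z)) : ℝ :=
  ∏ i, ch.outAll (x i) (t.1 i, t.2.1 i, t.2.2 i)

/-- A tuple of sequences is read as one sequence of tuples, whose law is then a product. -/
theorem sum_block_joint (n : ℕ)
    (F : (Fin n → U) → (Fin n → X) → (Fin n → S) × (Fin n → Y) × (Fin n → Z) → ℝ) :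
    ∑ u : Fin n → U, ∑ x : Fin n → X, (∏ i, pU (u i)) * (∏ i, Q (u i) (x i)) * ∑ t, ch.outAllN n x t * F u x t =
      ∑ ω : Fin n → U × X × S × Y × Z, (∏ i, ch.joint (inputPmf pU Q) (ω i)) *
        F (fun i => (ω i).1) (fun i => (ω i).2.1)
          (fun i => (ω i).2.2.1, fun i => (ω i).2.2.2.1, fun i => (ω i).2.2.2.2) := by
  simp only [sum_prod_arrow₃, Finset.mul_sum]
  rw [sum_arrow_prod₃]
  refine Finset.sum_congr rfl fun ω _ => ?_
  simp only [outAllN, ← mul_assoc, ← Finset.prod_mul_distrib]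
  congr 1
  exact Finset.prod_congr rfl fun i _ => by simp only [joint, inputPmf, outAll]; ring

theorem sum_block_satellite (n : ℕ)
    (F : (Fin n → U) → (Fin n → X) → (Fin n → S) × (Fin n → Y) × (Fin n → Z) → ℝ) :
    ∑ u : Fin n → U, ∑ x : Fin n → X, ∑ x', (∏ i, pU (u i)) * (∏ i, Q (u i) (x i)) * (∏ i, Q (u i) (x' i)) *
      ∑ t, ch.outAllN n x t * F u x' t =
      ∑ ω : Fin n → U × X × X × S × Y × Z, (∏ i, ch.satellitePmf pU Q (ω i)) *
        F (fun i => (ω i).1) (fun i => (ω i).2.2.1)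
          (fun i => (ω i).2.2.2.1, fun i => (ω i).2.2.2.2.1, fun i => (ω i).2.2.2.2.2) := by
  simp only [sum_prod_arrow₃, Finset.mul_sum]
  rw [sum_arrow_prod₄]
  refine Finset.sum_congr rfl fun ω _ => ?_
  simp only [outAllN, ← mul_assoc, ← Finset.prod_mul_distrib]
  rfl

theorem sum_block_cloudPair (n : ℕ)
    (F : (Fin n → U) → (Fin n → X) → (Fin n → S) × (Fin n → Y) × (Fin n → Z) → ℝ) :
    ∑ u : Fin n → U, ∑ x : Fin n → X, ∑ u', ∑ x', (∏ i, pU (u i)) * (∏ i, Q (u i) (x i)) *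
        ((∏ i, pU (u' i)) * ∏ i, Q (u' i) (x' i)) * ∑ t, ch.outAllN n x t * F u' x' t =
      ∑ ω : Fin n → U × X × U × X × S × Y × Z, (∏ i, ch.cloudPairPmf pU Q (ω i)) *
        F (fun i => (ω i).2.2.1) (fun i => (ω i).2.2.2.1)
          (fun i => (ω i).2.2.2.2.1, fun i => (ω i).2.2.2.2.2.1,
            fun i => (ω i).2.2.2.2.2.2) := by
  simp only [sum_prod_arrow₃, Finset.mul_sum]
  rw [sum_arrow_prod₅]
  refine Finset.sum_congr rfl fun ω _ => ?_
  simp only [outAllN, ← mul_assoc, ← Finset.prod_mul_distrib]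
  congr 1
  exact Finset.prod_congr rfl fun i _ => by simp only [cloudPairPmf]; ring

/-- The error bound of a random superposition code with decoding thresholds `γ₀` (common message),
`γ` (wrong cloud) and `γ₁` (right cloud, wrong satellite). -/
def errorBound (pU : U → ℝ) (Q : U → X → ℝ) (γ₀ γ γ₁ : ℝ) (n M₀ M₁ : ℕ) : ℝ :=
  (∑ b : Fin n → U × X × S × Y, (∏ i, ch.lawUXSY (inputPmf pU Q) (b i)) *
      (likelihoodSet (ch.lawUXSY (inputPmf pU Q)) (ch.lawCloud (inputPmf pU Q)) γ n)ᶜ.indicator 1 b) +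
    (∑ b : Fin n → U × X × S × Y, (∏ i, ch.lawUXSY (inputPmf pU Q) (b i)) *
      (likelihoodSet (ch.lawUXSY (inputPmf pU Q)) (ch.lawSatellite pU Q) γ₁ n)ᶜ.indicator 1 b) +
    (∑ b : Fin n → U × Z, (∏ i, ch.lawUZ (inputPmf pU Q) (b i)) *
      (likelihoodSet (ch.lawUZ (inputPmf pU Q)) (ch.lawUxZ (inputPmf pU Q)) γ₀ n)ᶜ.indicator 1 b) +
    ((M₀ : ℝ) - 1) * (2 : ℝ) ^ (-((n : ℝ) * γ₀)) +
    ((M₀ : ℝ) - 1) * M₁ * (2 : ℝ) ^ (-((n : ℝ) * γ)) +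
    ((M₁ : ℝ) - 1) * (2 : ℝ) ^ (-((n : ℝ) * γ₁))

/-- The expectation of `d (S, est (U, Z))`. -/
def meanDistortion (P : U × X → ℝ) (est : U → Z → S) : ℝ :=
  ∑ ω, ch.joint P ω * ch.d ω.2.2.1 (est ω.1 ω.2.2.2.2)

/-- The one-shot bound is applied to the product alphabets. Each of its averages is a block sum over
an i.i.d. law, and projecting to the tested variables turns it into a missed detection or a false
alarm of a likelihood test. -/
theorem exists_block_codebook (hpU : pU ∈ stdSimplex ℝ U) (hQ : ∀ u, Q u ∈ stdSimplex ℝ X)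
    (est : U → Z → S) (γ₀ γ γ₁ : ℝ) (n M₀ M₁ : ℕ) [NeZero M₀] [NeZero M₁] {κ : ℝ} (hκ : 0 ≤ κ) :
    ∃ (A₁ : Set ((Fin n → U) × (Fin n → X) × (Fin n → S) × (Fin n → Y)))
      (A₂ : Set ((Fin n → U) × (Fin n → Z)))
      (c : Fin M₀ → (Fin n → U) × (Fin M₁ → (Fin n → X))),
      ((M₀ : ℝ) * M₁)⁻¹ * ∑ w₀, ∑ w₁, ∑ t, ch.outAllN n ((c w₀).2 w₁) t *
        ((1 / (n : ℝ)) * (∑ i, ch.d (t.1 i) (est ((c w₀).1 i) (t.2.2 i))) +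
          κ * (errorEvent A₁ A₂ c w₀ w₁).indicator 1 t) ≤
      ch.meanDistortion (inputPmf pU Q) est + κ * ch.errorBound pU Q γ₀ γ γ₁ n M₀ M₁ := by
  set P := inputPmf pU Q
  have hP : P ∈ stdSimplex ℝ _ := inputPmf_mem hpU hQ
  set LC := likelihoodSet (ch.lawUXSY P) (ch.lawCloud P) γ n
  set LS := likelihoodSet (ch.lawUXSY P) (ch.lawSatellite pU Q) γ₁ n
  set LZ := likelihoodSet (ch.lawUZ P) (ch.lawUxZ P) γ₀ n
  have hUXSY : ch.lawUXSY P ∈ stdSimplex ℝ (U × X × S × Y) := by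
    rw [← law_joint_UXSY]; exact law_mem_stdSimplex (ch.joint_mem hP) _
  have hUZ : ch.lawUZ P ∈ stdSimplex ℝ (U × Z) := by
    rw [← law_joint_UZ]; exact law_mem_stdSimplex (ch.joint_mem hP) _
  -- Two thresholds at once: `LC` rejects wrong clouds and `LS` rejects wrong satellites of the
  -- right cloud. Each false alarm below uses just one of them.
  let A₁ : Set ((Fin n → U) × (Fin n → X) × (Fin n → S) × (Fin n → Y)) :=
    {a | (fun i => (a.1 i, a.2.1 i, a.2.2.1 i, a.2.2.2 i)) ∈ LC ∩ LS}
  let A₂ : Set ((Fin n → U) × (Fin n → Z)) := {a | (fun i => (a.1 i, a.2 i)) ∈ LZ}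
  obtain ⟨c, hc⟩ := exists_codebook_cost_le (M₀ := M₀) (M₁ := M₁)
    (pU := fun u : Fin n → U => ∏ i, pU (u i))
    (Q := fun (u : Fin n → U) (x : Fin n → X) => ∏ i, Q (u i) (x i))
    (prod_mem_stdSimplex fun _ => hpU) (fun u => prod_mem_stdSimplex fun i => hQ (u i))
    (V := ch.outAllN n) (fun x t => Finset.prod_nonneg fun i _ => (ch.outAll_mem _).1 _) A₁ A₂
    (fun u t => (1 / (n : ℝ)) * ∑ i, ch.d (t.1 i) (est (u i) (t.2.2 i))) hκ
  refine ⟨A₁, A₂, c, hc.trans ?_⟩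
  have hM₀ : (0 : ℝ) ≤ (M₀ : ℝ) - 1 := by
    rw [sub_nonneg]; exact_mod_cast NeZero.one_le
  have hM₁ : (0 : ℝ) ≤ (M₁ : ℝ) - 1 := by
    rw [sub_nonneg]; exact_mod_cast NeZero.one_le
  refine add_le_add ?_ (mul_le_mul_of_nonneg_left ?_ hκ)
  · rw [ch.sum_block_joint n fun u x t => (1 / (n : ℝ)) * ∑ i, ch.d (t.1 i) (est (u i) (t.2.2 i))]
    exact sum_prod_mul_mean (ch.joint_mem hP) (g := fun ω => ch.d ω.2.2.1 (est ω.1 ω.2.2.2.2))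
      (fun ω => ch.d_nonneg _ _) n
  have e1 := ch.sum_block_joint (pU := pU) (Q := Q) n fun u x t =>
    A₁ᶜ.indicator 1 (u, x, t.1, t.2.1)
  have e2 := ch.sum_block_joint (pU := pU) (Q := Q) n fun u x t => A₂ᶜ.indicator 1 (u, t.2.2)
  have e3 := ch.sum_block_cloudPair (pU := pU) (Q := Q) n fun u x t =>
    A₂.indicator 1 (u, t.2.2)
  have e4 := ch.sum_block_cloudPair (pU := pU) (Q := Q) n fun u x t =>
    A₁.indicator 1 (u, x, t.1, t.2.1)
  have e5 := ch.sum_block_satellite (pU := pU) (Q := Q) n fun u x t =>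
    A₁.indicator 1 (u, x, t.1, t.2.1)
  rw [e1, e2, e3, e4, e5]
  have f1 := sum_iid_comp (ι := Fin n) (ch.joint P)
    (fun ω => (ω.1, ω.2.1, ω.2.2.1, ω.2.2.2.1)) ((LC ∩ LS)ᶜ.indicator 1)
  have f2 := sum_iid_comp (ι := Fin n) (ch.joint P) (fun ω => (ω.1, ω.2.2.2.2)) (LZᶜ.indicator 1)
  have f3 := sum_iid_comp (ι := Fin n) (ch.cloudPairPmf pU Q)
    (fun ω => (ω.2.2.1, ω.2.2.2.2.2.2)) (LZ.indicator 1)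
  have f4 := sum_iid_comp (ι := Fin n) (ch.cloudPairPmf pU Q)
    (fun ω => (ω.2.2.1, ω.2.2.2.1, ω.2.2.2.2.1, ω.2.2.2.2.2.1)) ((LC ∩ LS).indicator 1)
  have f5 := sum_iid_comp (ι := Fin n) (ch.satellitePmf pU Q)
    (fun ω => (ω.1, ω.2.2.1, ω.2.2.2.1, ω.2.2.2.2.1)) ((LC ∩ LS).indicator 1)
  rw [law_joint_UXSY] at f1
  rw [law_joint_UZ] at f2
  rw [law_cloudPairPmf_UZ ch hQ] at f3
  rw [law_cloudPairPmf] at f4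
  rw [law_satellitePmf] at f5
  have hsub : ∀ {A B : Set (Fin n → U × X × S × Y)}, A ⊆ B → ∀ b,
      A.indicator (1 : (Fin n → U × X × S × Y) → ℝ) b ≤ B.indicator 1 b := fun h b =>
    Set.indicator_le_indicator_of_subset h (fun _ => zero_le_one) b
  have hcl0 : ∀ b, 0 ≤ ch.lawCloud P b := fun b => mul_nonneg (hP.1 _)
    (Finset.sum_nonneg fun u _ => Finset.sum_nonneg fun x _ =>
      mul_nonneg (hP.1 _) ((ch.outSY_mem x).1 _))
  have hsat0 : ∀ b, 0 ≤ ch.lawSatellite pU Q b := fun b => mul_nonneg (hP.1 (b.1, b.2.1))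
    (Finset.sum_nonneg fun x _ => mul_nonneg ((hQ _).1 _) ((ch.outSY_mem x).1 _))
  unfold errorBound
  refine add_le_add (add_le_add (add_le_add (add_le_add ?_ ?_) ?_) ?_) ?_
  · refine (Eq.trans ?_ f1).trans_le ?_
    · rfl
    rw [← Finset.sum_add_distrib]
    refine Finset.sum_le_sum fun b _ => ?_
    rw [← mul_add]
    exact mul_le_mul_of_nonneg_left (indicator_compl_inter_le LC LS b)
      (Finset.prod_nonneg fun i _ => hUXSY.1 _)
  · exact (Eq.trans rfl f2).le
  · refine mul_le_mul_of_nonneg_left ((Eq.trans ?_ f3).trans_le ?_) hM₀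
    · rfl
    exact sum_likelihoodSet_le hUZ γ₀ n
  · refine mul_le_mul_of_nonneg_left ((Eq.trans ?_ f4).trans_le ?_)
      (mul_nonneg hM₀ (Nat.cast_nonneg _))
    · rfl
    refine le_trans (Finset.sum_le_sum fun b _ => mul_le_mul_of_nonneg_left
      (hsub Set.inter_subset_left b) (Finset.prod_nonneg fun i _ => hcl0 _)) ?_
    exact sum_likelihoodSet_le hUXSY γ n
  · refine mul_le_mul_of_nonneg_left ((Eq.trans ?_ f5).trans_le ?_) hM₁
    · rfl
    refine le_trans (Finset.sum_le_sum fun b _ => mul_le_mul_of_nonneg_left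
      (hsub Set.inter_subset_right b) (Finset.prod_nonneg fun i _ => hsat0 _)) ?_
    exact sum_likelihoodSet_le hUXSY γ₁ n

end SDMBC

/-! ### Growth of the message sets against the exponents. -/

namespace SDMBC

theorem numMessages_pos (R : ℝ) (n : ℕ) : 0 < numMessages R n :=
  Nat.ceil_pos.2 (by positivity)

theorem numMessages_zero (n : ℕ) : numMessages 0 n = 1 := by simp [numMessages]

theorem numMessages_sub_one_le (R : ℝ) (n : ℕ) :
    (numMessages R n : ℝ) - 1 ≤ (2 : ℝ) ^ ((n : ℝ) * R) := by
  have := Nat.ceil_lt_add_one (show (0 : ℝ) ≤ (2 : ℝ) ^ ((n : ℝ) * R) by positivity)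
  rw [numMessages]
  linarith

theorem one_le_numMessages (R : ℝ) (n : ℕ) : (1 : ℝ) ≤ numMessages R n := by
  exact_mod_cast numMessages_pos R n

theorem numMessages_le {R : ℝ} (hR : 0 ≤ R) (n : ℕ) :
    (numMessages R n : ℝ) ≤ 2 * (2 : ℝ) ^ ((n : ℝ) * R) := by
  have h1 := numMessages_sub_one_le R n
  have h2 : (1 : ℝ) ≤ (2 : ℝ) ^ ((n : ℝ) * R) := Real.one_le_rpow one_le_two (by positivity)
  linarith

theorem tendsto_two_rpow_neg {a : ℝ} (ha : 0 < a) :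
    Tendsto (fun n : ℕ => (2 : ℝ) ^ (-((n : ℝ) * a))) atTop (𝓝 0) := by
  have h : ∀ n : ℕ, (2 : ℝ) ^ (-((n : ℝ) * a)) = ((2 : ℝ) ^ (-a)) ^ n := fun n => by
    rw [← Real.rpow_natCast, ← Real.rpow_mul zero_le_two]
    congr 1; ring
  simp only [h]
  exact tendsto_pow_atTop_nhds_zero_of_lt_one (by positivity)
    (Real.rpow_lt_one_of_one_lt_of_neg one_lt_two (neg_lt_zero.2 ha))

/-- At rate zero there is one message and no competitor, so the term is exactly zero whatever `γ`
is. Hence the count `M - 1` is kept rather than `M`. -/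
theorem tendsto_numMessages_sub_one_mul {R γ : ℝ} (h : R = 0 ∨ R < γ) :
    Tendsto (fun n => ((numMessages R n : ℝ) - 1) * (2 : ℝ) ^ (-((n : ℝ) * γ))) atTop (𝓝 0) := by
  rcases h with rfl | h
  · simp [numMessages_zero]
  refine squeeze_zero (fun n => mul_nonneg (sub_nonneg.2 (one_le_numMessages R n)) (by positivity))
    (fun n => ?_) (tendsto_two_rpow_neg (sub_pos.2 h))
  calc _ ≤ (2 : ℝ) ^ ((n : ℝ) * R) * (2 : ℝ) ^ (-((n : ℝ) * γ)) :=
        mul_le_mul_of_nonneg_right (numMessages_sub_one_le R n) (by positivity)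
    _ = _ := by rw [← Real.rpow_add two_pos]; congr 1; ring

/-- With a single cloud there is no wrong cloud, so `R₀ = 0` alone removes the sum-rate condition.
-/
theorem tendsto_numMessages_pair {R₀ R₁ γ : ℝ} (hR₁ : 0 ≤ R₁) (h : R₀ = 0 ∨ R₀ + R₁ < γ) :
    Tendsto (fun n => ((numMessages R₀ n : ℝ) - 1) * numMessages R₁ n *
      (2 : ℝ) ^ (-((n : ℝ) * γ))) atTop (𝓝 0) := by
  rcases h with rfl | h
  · simp [numMessages_zero]
  have ht := (tendsto_two_rpow_neg (sub_pos.2 h)).const_mul 2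
  rw [mul_zero] at ht
  refine squeeze_zero (fun n => mul_nonneg (mul_nonneg (sub_nonneg.2 (one_le_numMessages R₀ n))
    (Nat.cast_nonneg _)) (by positivity)) (fun n => ?_) ht
  calc _ ≤ (2 : ℝ) ^ ((n : ℝ) * R₀) * (2 * (2 : ℝ) ^ ((n : ℝ) * R₁)) *
        (2 : ℝ) ^ (-((n : ℝ) * γ)) :=
        mul_le_mul_of_nonneg_right (mul_le_mul (numMessages_sub_one_le R₀ n)
          (numMessages_le hR₁ n) (Nat.cast_nonneg _) (by positivity)) (by positivity)
    _ = 2 * ((2 : ℝ) ^ ((n : ℝ) * R₀) * (2 : ℝ) ^ ((n : ℝ) * R₁) *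
        (2 : ℝ) ^ (-((n : ℝ) * γ))) := by ring
    _ = _ := by
      rw [← Real.rpow_add two_pos, ← Real.rpow_add two_pos]
      congr 2; ring

end SDMBC

theorem exists_marginal_kernel {U X : Type*} [Fintype U] [Fintype X] {P : U × X → ℝ}
    (hP : P ∈ stdSimplex ℝ (U × X)) :
    ∃ pU ∈ stdSimplex ℝ U, ∃ Q : U → X → ℝ, (∀ u, Q u ∈ stdSimplex ℝ X) ∧
      ∀ u x, P (u, x) = pU u * Q u x := by
  classical
  have hsum : ∑ u, ∑ x, P (u, x) = 1 := by rw [← Fintype.sum_prod_type']; exact hP.2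
  -- On a row of zero mass any pmf would do for the kernel; the input marginal is one at hand.
  refine ⟨fun u => ∑ x, P (u, x), ⟨fun u => Finset.sum_nonneg fun x _ => hP.1 _, hsum⟩,
    fun u x => if ∑ x, P (u, x) = 0 then ∑ u, P (u, x) else P (u, x) / ∑ x, P (u, x),
    fun u => ?_, fun u x => ?_⟩
  · by_cases h : ∑ x, P (u, x) = 0
    · simp only [h, if_true]
      exact ⟨fun x => Finset.sum_nonneg fun u _ => hP.1 _, by rw [Finset.sum_comm]; exact hsum⟩
    · simp only [h, if_false]
      exact ⟨fun x => div_nonneg (hP.1 _) (Finset.sum_nonneg fun x _ => hP.1 _), by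
        rw [← Finset.sum_div, div_self h]⟩
  · by_cases h : ∑ x, P (u, x) = 0
    · simp only [h, if_true, zero_mul]
      exact (Finset.sum_eq_zero_iff_of_nonneg fun x _ => hP.1 _).1 h x (Finset.mem_univ x)
    · simp only [h, if_false]
      field_simp

/-! ### Achievability: divergences as informations, codes, and the limit. -/

namespace SDMBC

variable {U X S Y Z : Type*} [Fintype U] [Fintype X] [Fintype S] [Fintype Y] [Fintype Z]
variable (ch : SDMBC X S Y Z)

/-- Total expectation; for `u` of zero mass the numerator vanishes too, so the convention for
division is harmless. -/
theorem oneShotDistortion_eq {P : U × X → ℝ} (hP : ∀ a, 0 ≤ P a) (est : U → Z → S) :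
    ch.oneShotDistortion P est = ch.meanDistortion P est := by
  classical
  have hc : ∀ u, (∑ x, P (u, x)) * ch.condDistortion P est u =
      ∑ t : X × S × Y × Z, ch.joint P (u, t) * ch.d t.2.1 (est u t.2.2.2) := by
    intro u
    have hnum : (∑ ω, Set.indicator {ω : U × X × S × Y × Z | ω.1 = u}
        (fun (u, x, s, y, z) => ch.joint P (u, x, s, y, z) * ch.d s (est u z)) ω) =
        ∑ t : X × S × Y × Z, ch.joint P (u, t) * ch.d t.2.1 (est u t.2.2.2) := by
      rw [Fintype.sum_prod_type]
      simp [Set.indicator_apply]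
    rw [condDistortion, law_U, hnum]
    by_cases h : ∑ x, P (u, x) = 0
    · rw [h, zero_mul]
      refine (Finset.sum_eq_zero fun t _ => ?_).symm
      have h0 := (Finset.sum_eq_zero_iff_of_nonneg fun x _ => hP (u, x)).1 h t.1
        (Finset.mem_univ _)
      simp [joint, h0]
    · field_simp
  simp only [oneShotDistortion, ← Finset.sum_mul, hc, meanDistortion, Fintype.sum_prod_type (α₁ := U)]

variable {pU : U → ℝ} {Q : U → X → ℝ}

theorem sum_lawUZ_logb (P : U × X → ℝ) :
    ∑ b, ch.lawUZ P b * Real.logb 2 (ch.lawUZ P b / ch.lawUxZ P b) = ch.infoUZ P := by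
  rw [infoUZ_eq, Fintype.sum_prod_type]
  rfl

theorem sum_lawUXSY_logb_lawSatellite (hQ : ∀ u, Q u ∈ stdSimplex ℝ X) :
    ∑ b, ch.lawUXSY (inputPmf pU Q) b * Real.logb 2 (ch.lawUXSY (inputPmf pU Q) b /
      ch.lawSatellite pU Q b) = ch.infoXYgivenUS (inputPmf pU Q) := by
  simp only [infoXYgivenUS_eq, sum_inputPmf hQ]
  simp only [Fintype.sum_prod_type (α₁ := U), Fintype.sum_prod_type (α₁ := X)]
  refine Finset.sum_congr rfl fun u _ => Finset.sum_congr rfl fun x _ =>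
    Finset.sum_congr rfl fun t _ => ?_
  simp only [lawUXSY, lawSatellite, inputPmf]
  by_cases h0 : pU u * Q u x = 0
  · simp [h0]
  have hu := left_ne_zero_of_mul h0
  congr 2
  simp only [mul_assoc (pU u), ← Finset.mul_sum]
  rw [← mul_assoc (pU u), ← mul_assoc (pU u), mul_div_mul_left _ _ h0, mul_comm _ (pU u),
    mul_div_mul_left _ _ hu]

/-- The divergence is `I(U,X;S,Y)`. The factor `P (u, x)` cancels, since the output depends on `(U,
X)` only through `X`. -/
theorem sum_lawUXSY_logb_lawCloud {P : U × X → ℝ} (hP : ∑ a, P a = 1) :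
    ∑ b, ch.lawUXSY P b * Real.logb 2 (ch.lawUXSY P b / ch.lawCloud P b) =
      ch.infoXYgivenS P := by
  simp only [infoXYgivenS_eq ch hP, Finset.sum_mul]
  simp only [Fintype.sum_prod_type (α₁ := U), Fintype.sum_prod_type (α₁ := X)]
  rw [Finset.sum_comm]
  refine Finset.sum_congr rfl fun x _ => ?_
  rw [Finset.sum_comm]
  refine Finset.sum_congr rfl fun t _ => Finset.sum_congr rfl fun u _ => ?_
  simp only [lawUXSY, lawCloud]
  by_cases h0 : P (u, x) = 0
  · simp [h0]
  rw [mul_div_mul_left _ _ h0]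

theorem lawUXSY_eq_zero_of_lawCloud {P : U × X → ℝ} (hP : ∀ a, 0 ≤ P a) {b : U × X × S × Y}
    (hb : ch.lawCloud P b = 0) : ch.lawUXSY P b = 0 := by
  have h0 : ∀ u x, 0 ≤ P (u, x) * ch.outSY x b.2.2 := fun u x =>
    mul_nonneg (hP _) ((ch.outSY_mem x).1 _)
  rcases mul_eq_zero.1 hb with hb | hb
  · simp only [lawUXSY, hb, zero_mul]
  · have h1 := (Finset.sum_eq_zero_iff_of_nonneg fun u _ =>
      Finset.sum_nonneg fun x _ => h0 u x).1 hb b.1 (Finset.mem_univ _)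
    exact (Finset.sum_eq_zero_iff_of_nonneg fun x _ => h0 _ x).1 h1 b.2.1 (Finset.mem_univ _)

theorem lawUXSY_eq_zero_of_lawSatellite (hQ : ∀ u, Q u ∈ stdSimplex ℝ X) {b : U × X × S × Y}
    (hb : ch.lawSatellite pU Q b = 0) : ch.lawUXSY (inputPmf pU Q) b = 0 := by
  rcases mul_eq_zero.1 hb with hb | hb
  · simp only [lawUXSY, inputPmf, hb, zero_mul]
  · have h1 := (Finset.sum_eq_zero_iff_of_nonneg fun x _ =>
      mul_nonneg ((hQ b.1).1 x) ((ch.outSY_mem x).1 b.2.2)).1 hb b.2.1 (Finset.mem_univ _)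
    simp only [lawUXSY, inputPmf, mul_assoc, h1, mul_zero]

theorem lawUZ_eq_zero_of_lawUxZ {P : U × X → ℝ} (hP : ∀ a, 0 ≤ P a) {b : U × Z}
    (hb : ch.lawUxZ P b = 0) : ch.lawUZ P b = 0 := by
  rcases mul_eq_zero.1 hb with hb | hb
  · refine Finset.sum_eq_zero fun x _ => ?_
    rw [(Finset.sum_eq_zero_iff_of_nonneg fun x _ => hP _).1 hb x (Finset.mem_univ _), zero_mul]
  · exact (Finset.sum_eq_zero_iff_of_nonneg fun u _ => Finset.sum_nonneg fun x _ =>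
      mul_nonneg (hP _) ((ch.outZ_mem x).1 _)).1 hb b.1 (Finset.mem_univ _)

theorem tendsto_errorBound (hpU : pU ∈ stdSimplex ℝ U) (hQ : ∀ u, Q u ∈ stdSimplex ℝ X)
    {R₀ R₁ γ₀ γ γ₁ : ℝ} (hR₁ : 0 ≤ R₁)
    (hγ₀ : γ₀ < ch.infoUZ (inputPmf pU Q)) (hγ : γ < ch.infoXYgivenS (inputPmf pU Q))
    (hγ₁ : γ₁ < ch.infoXYgivenUS (inputPmf pU Q))
    (h₀ : R₀ = 0 ∨ R₀ < γ₀) (h : R₀ = 0 ∨ R₀ + R₁ < γ) (h₁ : R₁ = 0 ∨ R₁ < γ₁) :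
    Tendsto (fun n => ch.errorBound pU Q γ₀ γ γ₁ n (numMessages R₀ n) (numMessages R₁ n))
      atTop (𝓝 0) := by
  have hP := inputPmf_mem hpU hQ
  have hUXSY : ch.lawUXSY (inputPmf pU Q) ∈ stdSimplex ℝ (U × X × S × Y) := by
    rw [← law_joint_UXSY]; exact law_mem_stdSimplex (ch.joint_mem hP) _
  have hUZ : ch.lawUZ (inputPmf pU Q) ∈ stdSimplex ℝ (U × Z) := by
    rw [← law_joint_UZ]; exact law_mem_stdSimplex (ch.joint_mem hP) _
  have hs0 : ∀ t, 0 ≤ ∑ u, ∑ x, inputPmf pU Q (u, x) * ch.outSY x t := fun t =>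
    Finset.sum_nonneg fun u _ => Finset.sum_nonneg fun x _ =>
      mul_nonneg (hP.1 _) ((ch.outSY_mem x).1 _)
  have hz0 : ∀ z u, 0 ≤ ∑ x, inputPmf pU Q (u, x) * ch.outZ x z := fun z u =>
    Finset.sum_nonneg fun x _ => mul_nonneg (hP.1 _) ((ch.outZ_mem x).1 _)
  rw [← sum_lawUZ_logb] at hγ₀
  rw [← sum_lawUXSY_logb_lawCloud ch hP.2] at hγ
  rw [← sum_lawUXSY_logb_lawSatellite ch hQ] at hγ₁
  have t1 := tendsto_sum_likelihoodSet_compl hUXSY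
    (q := ch.lawCloud (inputPmf pU Q)) (fun b => mul_nonneg (hP.1 _) (hs0 _))
    (fun b => ch.lawUXSY_eq_zero_of_lawCloud hP.1) hγ
  have t2 := tendsto_sum_likelihoodSet_compl hUXSY
    (q := ch.lawSatellite pU Q) (fun b => mul_nonneg (hP.1 (b.1, b.2.1))
      (Finset.sum_nonneg fun x _ => mul_nonneg ((hQ _).1 _) ((ch.outSY_mem x).1 _)))
    (fun b => ch.lawUXSY_eq_zero_of_lawSatellite hQ) hγ₁
  have t3 := tendsto_sum_likelihoodSet_compl hUZ
    (q := ch.lawUxZ (inputPmf pU Q)) (fun b => mul_nonneg (Finset.sum_nonneg fun x _ => hP.1 _)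
      (Finset.sum_nonneg fun u _ => hz0 _ u)) (fun b => ch.lawUZ_eq_zero_of_lawUxZ hP.1) hγ₀
  have := ((((t1.add t2).add t3).add (tendsto_numMessages_sub_one_mul h₀)).add
    (tendsto_numMessages_pair hR₁ h)).add (tendsto_numMessages_sub_one_mul h₁)
  simp only [add_zero] at this
  exact this

theorem sum_blockPmf_mul {n M₀ M₁ : ℕ} (c : Code X S Y Z n M₀ M₁)
    (G : Outcome S Y Z n M₀ M₁ → ℝ) :
    ∑ ω, ch.blockPmf c ω * G ω = ((M₀ : ℝ) * M₁)⁻¹ * ∑ w₀, ∑ w₁, ∑ t,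
      ch.outAllN n (c.enc w₀ w₁) t * G (w₀, w₁, t) := by
  simp only [Fintype.sum_prod_type (α₁ := Fin M₀), Fintype.sum_prod_type (α₁ := Fin M₁),
    Finset.mul_sum]
  refine Finset.sum_congr rfl fun w₀ _ => Finset.sum_congr rfl fun w₁ _ =>
    Finset.sum_congr rfl fun t _ => ?_
  rw [← mul_assoc]
  rfl

theorem errorProb_eq {n M₀ M₁ : ℕ} (c : Code X S Y Z n M₀ M₁) :
    ch.errorProb c = ∑ ω, ch.blockPmf c ω * Set.indicator
      {ω | c.dec₁ ω.2.2.2.1 ω.2.2.1 ≠ (ω.1, ω.2.1) ∨ c.dec₂ ω.2.2.2.2 ≠ ω.1} 1 ω := by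
  classical
  refine Finset.sum_congr rfl fun ω _ => ?_
  rw [Set.indicator_apply, Set.indicator_apply, Pi.one_apply, mul_ite, mul_one, mul_zero]

theorem blockPmf_nonneg {n M₀ M₁ : ℕ} (c : Code X S Y Z n M₀ M₁)
    (ω : Outcome S Y Z n M₀ M₁) : 0 ≤ ch.blockPmf c ω :=
  mul_nonneg (by positivity) (Finset.prod_nonneg fun i _ =>
    mul_nonneg (ch.PS_mem.1 _) ((ch.W_mem _ _).1 _))

theorem errorProb_nonneg {n M₀ M₁ : ℕ} (c : Code X S Y Z n M₀ M₁) : 0 ≤ ch.errorProb c :=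
  Finset.sum_nonneg fun ω _ => Set.indicator_nonneg (fun ω _ => ch.blockPmf_nonneg c ω) ω

theorem expDistortion_nonneg {n M₀ M₁ : ℕ} (c : Code X S Y Z n M₀ M₁) :
    0 ≤ ch.expDistortion c :=
  Finset.sum_nonneg fun ω _ => mul_nonneg (ch.blockPmf_nonneg c ω)
    (mul_nonneg (by positivity) (Finset.sum_nonneg fun i _ => ch.d_nonneg _ _))

/-- A bound on the distortion function. -/
def maxDistortion : ℝ := ∑ s, ∑ t, ch.d s t

theorem d_le_maxDistortion (s t : S) : ch.d s t ≤ ch.maxDistortion :=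
  (Finset.single_le_sum (f := fun t => ch.d s t) (fun t _ => ch.d_nonneg s t)
    (Finset.mem_univ t)).trans
  (Finset.single_le_sum (f := fun s => ∑ t, ch.d s t)
    (fun s _ => Finset.sum_nonneg fun t _ => ch.d_nonneg s t) (Finset.mem_univ s))

theorem maxDistortion_nonneg : 0 ≤ ch.maxDistortion :=
  Finset.sum_nonneg fun s _ => Finset.sum_nonneg fun t _ => ch.d_nonneg s t

/-- The estimator uses the decoded centre. When the common message is right this matches the
genie-aided estimate; otherwise an error has occurred and the distortion is at most `maxDistortion`.
Raising the price by that constant removes the genie. -/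
theorem exists_code (hpU : pU ∈ stdSimplex ℝ U) (hQ : ∀ u, Q u ∈ stdSimplex ℝ X)
    (est : U → Z → S) (γ₀ γ γ₁ : ℝ) (n M₀ M₁ : ℕ) [NeZero M₀] [NeZero M₁] {κ : ℝ} (hκ : 0 ≤ κ) :
    ∃ c : Code X S Y Z n M₀ M₁,
      ch.expDistortion c + κ * ch.errorProb c ≤
        ch.meanDistortion (inputPmf pU Q) est + (ch.maxDistortion + κ) *
          ch.errorBound pU Q γ₀ γ γ₁ n M₀ M₁ := by
  classical
  obtain ⟨A₁, A₂, c, hc⟩ := ch.exists_block_codebook hpU hQ est γ₀ γ γ₁ n M₀ M₁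
    (add_nonneg ch.maxDistortion_nonneg hκ)
  let C : Code X S Y Z n M₀ M₁ :=
    { enc := fun w₀ w₁ => (c w₀).2 w₁
      dec₁ := fun y s => pairDecoder A₁ c y s
      dec₂ := fun z => commonDecoder A₂ c z
      est := fun z i => est ((c (commonDecoder A₂ c z)).1 i) (z i) }
  refine ⟨C, le_trans (le_of_eq ?_ |>.trans (ch.sum_blockPmf_mul C fun ω =>
    (1 / (n : ℝ)) * (∑ i, ch.d (ω.2.2.1 i) (C.est ω.2.2.2.2 i)) +
      κ * (errorEvent A₁ A₂ c ω.1 ω.2.1).indicator 1 ω.2.2).le) (le_trans ?_ hc)⟩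
  · rw [errorProb_eq, expDistortion, Finset.mul_sum, ← Finset.sum_add_distrib]
    refine Finset.sum_congr rfl fun ω _ => ?_
    rw [mul_add, mul_left_comm κ]
    rfl
  · refine mul_le_mul_of_nonneg_left (Finset.sum_le_sum fun w₀ _ => Finset.sum_le_sum fun w₁ _ =>
      Finset.sum_le_sum fun t _ => mul_le_mul_of_nonneg_left ?_
        (Finset.prod_nonneg fun i _ => (ch.outAll_mem _).1 _)) (by positivity)
    rw [add_mul, ← add_assoc]
    refine add_le_add_left ?_ _
    by_cases ht : commonDecoder A₂ c t.2.2 = w₀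
    · have h0 : 0 ≤ ch.maxDistortion * (errorEvent A₁ A₂ c w₀ w₁).indicator 1 t :=
        mul_nonneg ch.maxDistortion_nonneg (indicator_one_nonneg _ _)
      simp only [C, ht]
      linarith
    · have hmem : t ∈ errorEvent A₁ A₂ c w₀ w₁ := Or.inr ht
      rw [Set.indicator_of_mem hmem, Pi.one_apply, mul_one]
      have h0 : 0 ≤ (1 / (n : ℝ)) * (∑ i, ch.d (t.1 i) (est ((c w₀).1 i) (t.2.2 i))) :=
        mul_nonneg (by positivity) (Finset.sum_nonneg fun i _ => ch.d_nonneg _ _)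
      refine le_trans ?_ (le_add_of_nonneg_left h0)
      refine (mul_le_mul_of_nonneg_left (Finset.sum_le_sum fun i _ =>
        ch.d_le_maxDistortion _ _) (by positivity)).trans ?_
      simp only [Finset.sum_const, Finset.card_univ, Fintype.card_fin, nsmul_eq_mul]
      rw [← mul_assoc]
      -- The factor is `n⁻¹ * n`, which is `0` rather than `1` at `n = 0`.
      refine mul_le_of_le_one_left ch.maxDistortion_nonneg ?_
      rw [one_div]
      exact inv_mul_le_one

theorem exists_threshold {R I : ℝ} {p : Prop} (h : p ∨ R < I) : ∃ γ < I, p ∨ R < γ := by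
  rcases h with h | h
  · exact ⟨I - 1, by linarith, Or.inl h⟩
  · obtain ⟨γ, h1, h2⟩ := exists_between h
    exact ⟨γ, h2, Or.inr h1⟩

/-- With `E` dominating the error bound and price `1 / √E`, the cost is at most `Dm + B E + √E`.
Dropping the error term bounds the distortion; dropping the distortion and multiplying by `√E`
bounds the error probability. -/
theorem isAchievable_of_lt {P : U × X → ℝ} (hP : P ∈ stdSimplex ℝ (U × X)) (est : U → Z → S)
    {R₀ R₁ D : ℝ} (hR₀ : 0 ≤ R₀) (hR₁ : 0 ≤ R₁) (hD : ch.oneShotDistortion P est ≤ D)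
    (h₀ : R₀ = 0 ∨ R₀ < ch.infoUZ P) (h₁ : R₁ = 0 ∨ R₁ < ch.infoXYgivenUS P)
    (h : R₀ + R₁ = 0 ∨ R₀ + R₁ < ch.infoXYgivenS P) : ch.IsAchievable R₀ R₁ D := by
  obtain ⟨pU, hpU, Q, hQ, hPQ⟩ := exists_marginal_kernel hP
  obtain rfl : P = inputPmf pU Q := funext fun ⟨u, x⟩ => hPQ u x
  have h' : R₀ = 0 ∨ R₀ + R₁ < ch.infoXYgivenS (inputPmf pU Q) :=
    h.imp_left fun h => by linarith
  obtain ⟨γ₀, hγ₀, h₀⟩ := exists_threshold h₀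
  obtain ⟨γ, hγ, h'⟩ := exists_threshold h'
  obtain ⟨γ₁, hγ₁, h₁⟩ := exists_threshold h₁
  have hE := ch.tendsto_errorBound hpU hQ hR₁ hγ₀ hγ hγ₁ h₀ h' h₁
  rw [oneShotDistortion_eq ch hP.1] at hD
  set Dm := ch.meanDistortion (inputPmf pU Q) est
  set B := ch.maxDistortion
  have hDm : 0 ≤ Dm := Finset.sum_nonneg fun ω _ =>
    mul_nonneg ((ch.joint_mem hP).1 ω) (ch.d_nonneg _ _)
  have : ∀ R n, NeZero (numMessages R n) := fun R n => ⟨(numMessages_pos R n).ne'⟩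
  -- the price of an error grows, but more slowly than the error bound decays
  set E : ℕ → ℝ := fun n => |ch.errorBound pU Q γ₀ γ γ₁ n (numMessages R₀ n) (numMessages R₁ n)| +
    1 / ((n : ℝ) + 1)
  -- The summand `1 / (n + 1)` is there for this: the price must make sense even where the error
  -- bound is zero.
  have hEpos : ∀ n, 0 < E n := fun n => by positivity
  have hE0 : Tendsto E atTop (𝓝 0) := by
    have := hE.abs.add tendsto_one_div_add_atTop_nhds_zero_nat
    rwa [abs_zero, add_zero] at this
  have hsq : Tendsto (fun n => √(E n)) atTop (𝓝 0) := by
    have := (Real.continuous_sqrt.tendsto 0).comp hE0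
    rwa [Real.sqrt_zero] at this
  choose c hc using fun n => ch.exists_code hpU hQ est γ₀ γ γ₁ n (numMessages R₀ n)
    (numMessages R₁ n) (κ := (√(E n))⁻¹) (by positivity)
  have hbound : ∀ n, ch.expDistortion (c n) + (√(E n))⁻¹ * ch.errorProb (c n) ≤
      Dm + B * E n + √(E n) := by
    intro n
    refine (hc n).trans ?_
    have hs : 0 < √(E n) := Real.sqrt_pos.2 (hEpos n)
    have h1 : ch.errorBound pU Q γ₀ γ γ₁ n (numMessages R₀ n) (numMessages R₁ n) ≤ E n :=
      (le_abs_self _).trans (le_add_of_nonneg_right (by positivity))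
    have h2 : (√(E n))⁻¹ * E n = √(E n) := by
      rw [inv_mul_eq_div, Real.div_sqrt]
    have h3 := mul_le_mul_of_nonneg_left h1
      (add_nonneg ch.maxDistortion_nonneg (inv_nonneg.2 hs.le))
    rw [add_mul _ _ (E n), h2] at h3
    linarith
  have hlim : Tendsto (fun n => Dm + B * E n + √(E n)) atTop (𝓝 Dm) := by
    simpa using ((hE0.const_mul B).const_add Dm).add hsq
  refine ⟨hR₀, hR₁, c, ?_, ?_⟩
  · have hlim' := hsq.mul hlim
    rw [zero_mul] at hlim'
    refine squeeze_zero (fun n => ch.errorProb_nonneg _) (fun n => ?_) hlim'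
    have hs : 0 < √(E n) := Real.sqrt_pos.2 (hEpos n)
    have := (le_add_of_nonneg_left (ch.expDistortion_nonneg (c n))).trans (hbound n)
    rwa [inv_mul_le_iff₀ hs] at this
  · refine le_trans ?_ hD
    rw [← hlim.limsup_eq]
    refine limsup_le_limsup (Eventually.of_forall fun n => ?_) ?_ hlim.isBoundedUnder_le
    · exact (le_add_of_nonneg_right (mul_nonneg (by positivity) (ch.errorProb_nonneg _))).trans
        (hbound n)
    · exact isCoboundedUnder_le_of_le atTop fun n => ch.expDistortion_nonneg (c n)

theorem mem_capacityDistortionRegion_of_le {P : U × X → ℝ} (hP : P ∈ stdSimplex ℝ (U × X))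
    (est : U → Z → S) {R₀ R₁ D : ℝ} (hR₀ : 0 ≤ R₀) (hR₁ : 0 ≤ R₁)
    (hD : ch.oneShotDistortion P est ≤ D) (h₀ : R₀ ≤ ch.infoUZ P)
    (h₁ : R₁ ≤ ch.infoXYgivenUS P) (h : R₀ + R₁ ≤ ch.infoXYgivenS P) :
    (R₀, R₁, D) ∈ ch.capacityDistortionRegion := by
  -- Scaling by `a < 1` makes a positive rate strictly admissible and leaves a zero rate at zero.
  have key : ∀ {R I a : ℝ}, 0 ≤ R → R ≤ I → a < 1 → (a * R = 0 ∨ a * R < I) := by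
    intro R I a hR hI ha
    rcases hR.eq_or_lt with rfl | hR
    · left; simp
    · right; nlinarith
  have ht : Tendsto (fun n : ℕ => ((1 - 1 / ((n : ℝ) + 1)) * R₀, (1 - 1 / ((n : ℝ) + 1)) * R₁, D))
      atTop (𝓝 (R₀, R₁, D)) := by
    have h1 : Tendsto (fun n : ℕ => 1 - 1 / ((n : ℝ) + 1)) atTop (𝓝 1) := by
      simpa using tendsto_one_div_add_atTop_nhds_zero_nat.const_sub (1 : ℝ)
    refine Tendsto.prodMk_nhds ?_ (Tendsto.prodMk_nhds ?_ tendsto_const_nhds)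
    · simpa using h1.mul_const R₀
    · simpa using h1.mul_const R₁
  refine mem_closure_of_tendsto ht (Eventually.of_forall fun n => ?_)
  have ha : 1 - 1 / ((n : ℝ) + 1) < 1 := by
    have : (0 : ℝ) < 1 / ((n : ℝ) + 1) := by positivity
    linarith
  have ha0 : 0 ≤ 1 - 1 / ((n : ℝ) + 1) := by
    rw [sub_nonneg, div_le_one (by positivity)]
    linarith [(Nat.cast_nonneg n : (0 : ℝ) ≤ n)]
  refine ch.isAchievable_of_lt hP est (mul_nonneg ha0 hR₀) (mul_nonneg ha0 hR₁) hD
    (key hR₀ h₀ ha) (key hR₁ h₁ ha) ?_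
  rw [← mul_add]
  exact key (add_nonneg hR₀ hR₁) h ha

end SDMBC

/-! ### Fenchel–Eggleston theorem and reduction of the auxiliary alphabet. -/

section Caratheodory

/-- Fenchel–Eggleston strengthening of Carathéodory's theorem: a point in the convex hull of the
continuous image of a convex set that lies on an affine hyperplane `ℓ = 1` of `V` is a conic
combination of at most `finrank V - 1` points of the image. -/
theorem exists_combination_of_mem_convexHull_image {E V : Type*} [AddCommGroup E] [Module ℝ E]
    [TopologicalSpace E] [ContinuousAdd E] [ContinuousSMul ℝ E]
    [NormedAddCommGroup V] [NormedSpace ℝ V] [FiniteDimensional ℝ V]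
    {C : Set E} (hC : Convex ℝ C) {v : E → V} (hv : ContinuousOn v C) (ℓ : V →ₗ[ℝ] ℝ)
    (hℓ : ∀ p ∈ C, ℓ (v p) = 1) (hdim : 2 ≤ Module.finrank ℝ V) {T : V}
    (hT : T ∈ convexHull ℝ (v '' C)) :
    ∃ k : ℕ, k + 1 ≤ Module.finrank ℝ V ∧ ∃ (w : Fin k → ℝ) (p : Fin k → E),
      (∀ i, 0 ≤ w i) ∧ (∀ i, p i ∈ C) ∧ ∑ i, w i • v (p i) = T := by
  classical
  obtain ⟨ι, _, z, w, hz, hind, hw, hw1, hwT⟩ := eq_pos_convex_span_of_mem_convexHull hT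
  choose p hpC hpz using fun i => hz (Set.mem_range_self i)
  -- On the hyperplane `ℓ = 1` a vanishing linear combination has coefficient sum zero, so affine
  -- independence gives linear independence. Hence Carathéodory yields at most `finrank` points, and
  -- only equality needs more work.
  have hlin : LinearIndependent ℝ z := by
    rw [Fintype.linearIndependent_iff]
    intro g hg i
    have hsum : ∑ i, g i = 0 := by
      have := congrArg ℓ hg
      simpa [← hpz, hℓ _ (hpC _)] using this
    exact affineIndependent_iff.1 hind Finset.univ g hsum hg i (Finset.mem_univ i)
  rcases hlin.fintype_card_le_finrank.lt_or_eq with hcard | hcard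
  · refine ⟨Fintype.card ι, hcard, w ∘ (Fintype.equivFin ι).symm, p ∘ (Fintype.equivFin ι).symm,
      fun i => (hw _).le, fun i => hpC _, ?_⟩
    rw [← hwT, ← (Fintype.equivFin ι).symm.sum_comp fun i => w i • z i]
    simp [hpz]
  have hne : Nonempty ι := Fintype.card_pos_iff.1 (by omega)
  let b := basisOfLinearIndependentOfCardEqFinrank hlin hcard
  have hb : ∀ i, b i = z i := fun i => by simp [b]
  obtain ⟨i₀, i₁, hi⟩ := Fintype.one_lt_card_iff.1 (show 1 < Fintype.card ι by omega)
  -- Moving from `p i₀` to `p i₁` inside `C`, the ratio `c i₀` starts as the largest of the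
  -- coordinate-to-weight ratios and ends at zero. By the intermediate value theorem it ties at some
  -- time with the largest of the others.
  let γ : ℝ → E := fun t => (1 - t) • p i₀ + t • p i₁
  have hγC : ∀ t ∈ Set.Icc (0 : ℝ) 1, γ t ∈ C := fun t ht =>
    hC (hpC i₀) (hpC i₁) (sub_nonneg.2 ht.2) ht.1 (by ring)
  have hγ : Continuous γ := by fun_prop
  let c : ι → ℝ → ℝ := fun i t => b.coord i (v (γ t)) / w i
  have hc : ∀ i, ContinuousOn (c i) (Set.Icc 0 1) := fun i =>
    (((b.coord i).continuous_of_finiteDimensional.comp_continuousOn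
      (hv.comp hγ.continuousOn hγC)).div_const _)
  have hs : (Finset.univ.erase i₀).Nonempty := ⟨i₁, by simp [hi.symm]⟩
  let g : ℝ → ℝ := fun t => c i₀ t - (Finset.univ.erase i₀).sup' hs fun i => c i t
  have hg : ContinuousOn g (Set.Icc 0 1) :=
    (hc i₀).sub (ContinuousOn.finset_sup'_apply hs fun i _ => hc i)
  have hc0 : ∀ i, c i 0 = if i = i₀ then 1 / w i else 0 := fun i => by
    have : v (γ 0) = b i₀ := by simp [γ, hb, hpz]
    simp only [c, this, Module.Basis.coord_apply, Module.Basis.repr_self, Finsupp.single_apply, eq_comm (a := i)]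
    split_ifs <;> simp
  have hc1 : ∀ i, c i 1 = if i = i₁ then 1 / w i else 0 := fun i => by
    have : v (γ 1) = b i₁ := by simp [γ, hb, hpz]
    simp only [c, this, Module.Basis.coord_apply, Module.Basis.repr_self, Finsupp.single_apply, eq_comm (a := i)]
    split_ifs <;> simp
  have hg0 : 0 ≤ g 0 := by
    have h1 : (Finset.univ.erase i₀).sup' hs (fun i => c i 0) ≤ 0 :=
      Finset.sup'_le _ _ fun i hi' => by rw [hc0, if_neg (Finset.ne_of_mem_erase hi')]
    have h2 : 0 ≤ c i₀ 0 := by rw [hc0, if_pos rfl]; exact (one_div_pos.2 (hw _)).le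
    simp only [g]; linarith
  have hg1 : g 1 ≤ 0 := by
    have h1 : c i₁ 1 ≤ (Finset.univ.erase i₀).sup' hs (fun i => c i 1) :=
      Finset.le_sup' (fun i => c i 1) (by simp [hi.symm])
    have h2 : 0 ≤ c i₁ 1 := by rw [hc1, if_pos rfl]; exact (one_div_pos.2 (hw _)).le
    have h3 : c i₀ 1 = 0 := by rw [hc1, if_neg hi]
    simp only [g]; linarith
  obtain ⟨t, ht, hgt⟩ := intermediate_value_Icc' zero_le_one hg ⟨hg1, hg0⟩
  obtain ⟨j, hj, hjsup⟩ := Finset.exists_mem_eq_sup' hs fun i => c i t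
  have hji₀ : j ≠ i₀ := Finset.ne_of_mem_erase hj
  have hcj : c j t = c i₀ t := by
    simp only [g] at hgt; linarith
  have hcle : ∀ i, c i t ≤ c i₀ t := by
    intro i
    by_cases h : i = i₀
    · rw [h]
    · have := Finset.le_sup' (fun i => c i t) (Finset.mem_erase.2 ⟨h, Finset.mem_univ i⟩)
      simp only [g] at hgt; linarith
  have hexp : ∑ i, (w i * c i t) • z i = v (γ t) := by
    rw [← b.sum_repr (v (γ t))]
    refine Finset.sum_congr rfl fun i _ => ?_
    rw [hb]
    congr 1
    simp only [c, Module.Basis.coord_apply]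
    have := (hw i).ne'
    field_simp
  have hone : ∑ i, w i * c i t = 1 := by
    have := congrArg ℓ hexp
    simpa [← hpz, hℓ _ (hpC _), hℓ _ (hγC t ht)] using this
  have hμ : 0 < c i₀ t := by
    by_contra! h
    have : ∑ i, w i * c i t ≤ 0 := Finset.sum_nonpos fun i _ =>
      mul_nonpos_of_nonneg_of_nonpos (hw i).le ((hcle i).trans h)
    linarith
  -- Subtract `1 / c i₀ t` times the expansion of `v (γ t)` and add that multiple of the new point.
  -- This eliminates `z i₀`; maximality of `c i₀ t` keeps the other weights nonnegative, and the tie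
  -- kills the weight at `j`.
  let w' : ι → ℝ := fun i => if i = i₀ then (c i₀ t)⁻¹ else w i - (c i₀ t)⁻¹ * (w i * c i t)
  let p' : ι → E := fun i => if i = i₀ then γ t else p i
  have hw' : ∀ i, 0 ≤ w' i := by
    intro i
    simp only [w']
    split_ifs
    · exact (inv_pos.2 hμ).le
    · rw [sub_nonneg, inv_mul_le_iff₀ hμ, mul_comm]
      exact mul_le_mul_of_nonneg_right (hcle i) (hw i).le
  have hp' : ∀ i, p' i ∈ C := by
    intro i
    simp only [p']
    split_ifs
    exacts [hγC t ht, hpC i]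
  have hwj : w' j = 0 := by
    simp only [w', if_neg hji₀, hcj]
    field_simp
    simp
  have hsum : ∑ i, w' i • v (p' i) = T := by
    have h1 : ∀ i, w' i • v (p' i) = w i • z i - (c i₀ t)⁻¹ • ((w i * c i t) • z i) +
        if i = i₀ then (c i₀ t)⁻¹ • v (γ t) else 0 := by
      intro i
      by_cases h : i = i₀
      · subst h
        simp only [w', p', if_true]
        rw [smul_smul, show (c i t)⁻¹ * (w i * c i t) = w i by field_simp, sub_self, zero_add]
      · simp only [w', p', if_neg h, add_zero, hpz, sub_smul, smul_smul]
    simp only [h1, Finset.sum_add_distrib, Finset.sum_sub_distrib, ← Finset.smul_sum, hexp, hwT]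
    simp
  have hcard' : Fintype.card {i // i ≠ j} + 1 = Module.finrank ℝ V := by
    rw [← hcard, Fintype.card_subtype_compl (fun i => i = j), Fintype.card_subtype_eq]
    have : 0 < Fintype.card ι := Fintype.card_pos
    omega
  let e := Fintype.equivFin {i // i ≠ j}
  refine ⟨Fintype.card {i // i ≠ j}, hcard'.le, fun a => w' (e.symm a), fun a => p' (e.symm a),
    fun a => hw' _, fun a => hp' _, ?_⟩
  rw [e.symm.sum_comp fun i : {i // i ≠ j} => w' i • v (p' i), ← hsum,
    Fintype.sum_eq_add_sum_subtype_ne (fun i => w' i • v (p' i)) j, hwj, zero_smul, zero_add]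

/-- Support reduction: the rows of a joint pmf can be replaced by at most `|X| + m - 1` rows with the
same column sums and the same sums of `m` continuous positively homogeneous functions. -/
theorem exists_support_reduction {U X : Type*} [Fintype U] [Fintype X] {P : U × X → ℝ}
    (hP : P ∈ stdSimplex ℝ (U × X)) {m : ℕ} (hm : 1 ≤ m) (φ : Fin m → (X → ℝ) → ℝ)
    (hφ : ∀ j, Continuous (φ j)) (hhom : ∀ j (w : ℝ) r, 0 ≤ w → φ j (w • r) = w * φ j r) :
    ∃ k : ℕ, k + 1 ≤ Fintype.card X + m ∧ ∃ P' ∈ stdSimplex ℝ (Fin k × X),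
      (∀ x, ∑ u, P' (u, x) = ∑ u, P (u, x)) ∧
      ∀ j, ∑ u, φ j (fun x => P' (u, x)) = ∑ u, φ j (fun x => P (u, x)) := by
  obtain ⟨pU, hpU, Q, hQ, hPQ⟩ := exists_marginal_kernel hP
  have hX : 0 < Fintype.card X := by
    rw [Fintype.card_pos_iff]
    by_contra h
    rw [not_nonempty_iff] at h
    simpa using hP.2
  -- The row itself is kept among the coordinates to preserve the input marginal. The coordinate sum
  -- of that part gives the hyperplane, so of the `|X| + m` dimensions one is saved.
  let v : (X → ℝ) → (X ⊕ Fin m → ℝ) := fun r => Sum.elim r fun j => φ j r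
  have hv : Continuous v := continuous_pi fun a => by
    cases a with
    | inl x => exact continuous_apply x
    | inr j => exact hφ j
  let ℓ : (X ⊕ Fin m → ℝ) →ₗ[ℝ] ℝ := ∑ x, LinearMap.proj (Sum.inl x)
  have hℓ : ∀ r ∈ stdSimplex ℝ X, ℓ (v r) = 1 := fun r hr => by simp [ℓ, v, hr.2]
  have hT : ∑ u, pU u • v (Q u) ∈ convexHull ℝ (v '' stdSimplex ℝ X) :=
    (convex_convexHull ℝ _).sum_mem (fun u _ => hpU.1 u) hpU.2
      fun u _ => subset_convexHull ℝ _ (Set.mem_image_of_mem v (hQ u))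
  have hfin : Module.finrank ℝ (X ⊕ Fin m → ℝ) = Fintype.card X + m := by simp
  obtain ⟨k, hk, w, r, hw, hr, hsum⟩ := exists_combination_of_mem_convexHull_image
    (convex_stdSimplex ℝ X) hv.continuousOn ℓ hℓ (by omega) hT
  have hrow : ∀ u, (fun x => P (u, x)) = pU u • Q u := fun u => funext fun x => hPQ u x
  have hwsum : ∑ i, w i = 1 := by
    have := congrArg ℓ hsum
    simpa only [map_sum, map_smul, hℓ _ (hr _), hℓ _ (hQ _), smul_eq_mul, mul_one, hpU.2] using this
  refine ⟨k, by omega, fun a => w a.1 * r a.1 a.2, ⟨fun a => mul_nonneg (hw _) ((hr _).1 _), ?_⟩,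
    fun x => ?_, fun j => ?_⟩
  · simp only [Fintype.sum_prod_type, ← Finset.mul_sum, (hr _).2, mul_one, hwsum]
  · simpa [v, hPQ] using congrFun hsum (Sum.inl x)
  · have h := congrFun hsum (Sum.inr j)
    simp only [Finset.sum_apply, Pi.smul_apply, v, Sum.elim_inr, smul_eq_mul] at h
    simp only [hrow, hhom _ _ _ (hpU.1 _), ← h]
    exact Finset.sum_congr rfl fun i _ => hhom j (w i) (r i) (hw i)

end Caratheodory

/-! ### Informations and least distortion as sums over the rows of the joint pmf. -/

section Entropy

variable {X T : Type*} [Fintype X] [Fintype T]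

/-- The (unnormalized, in nats) entropy of the output of the channel `V` for the input weights `r`,
made positively homogeneous in `r`. -/
def outputEntropy (V : X → T → ℝ) (r : X → ℝ) : ℝ :=
  ∑ t, Real.negMulLog (∑ x, r x * V x t) - Real.negMulLog (∑ x, r x)

theorem continuous_outputEntropy (V : X → T → ℝ) : Continuous (outputEntropy V) := by
  unfold outputEntropy
  refine Continuous.sub (continuous_finsetSum _ fun t _ => ?_) ?_
  · exact Real.continuous_negMulLog.comp (by fun_prop)
  · exact Real.continuous_negMulLog.comp (by fun_prop)

/-- Both entropy terms produce the same `negMulLog w` correction, weighted by the total mass of `r`,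
and these cancel. -/
theorem outputEntropy_smul {V : X → T → ℝ} (hV : ∀ x, ∑ t, V x t = 1) (w : ℝ) (r : X → ℝ) :
    outputEntropy V (w • r) = w * outputEntropy V r := by
  have hsum : ∑ t, ∑ x, r x * V x t = ∑ x, r x := by
    rw [Finset.sum_comm]
    simp only [← Finset.mul_sum, hV, mul_one]
  simp only [outputEntropy, Pi.smul_apply, smul_eq_mul, mul_assoc, ← Finset.mul_sum,
    Real.negMulLog_mul, Finset.sum_add_distrib, ← Finset.sum_mul, hsum]
  ring

end Entropy

namespace SDMBC

variable {U X S Y Z : Type*} [Fintype U] [Fintype X] [Fintype S] [Fintype Y] [Fintype Z]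
variable (ch : SDMBC X S Y Z)

/-- This is `H(Z) - H(Z|U)` in nats; the first term depends only on the input marginal. -/
theorem infoUZ_mul_log {P : U × X → ℝ} (hP : ∀ a, 0 ≤ P a) : ch.infoUZ P * Real.log 2 =
    ∑ z, Real.negMulLog (∑ x, (∑ u, P (u, x)) * ch.outZ x z) -
      ∑ u, outputEntropy ch.outZ fun x => P (u, x) := by
  have hl : Real.log 2 ≠ 0 := (Real.log_pos one_lt_two).ne'
  have hZ : ∀ z, ∑ x, (∑ u, P (u, x)) * ch.outZ x z = ∑ u, ∑ x, P (u, x) * ch.outZ x z := by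
    intro z
    simp only [Finset.sum_mul]
    exact Finset.sum_comm
  have hU : ∀ u, ∑ z, ∑ x, P (u, x) * ch.outZ x z = ∑ x, P (u, x) := by
    intro u
    rw [Finset.sum_comm]
    simp only [← Finset.mul_sum, (ch.outZ_mem _).2, mul_one]
  have hterm : ∀ u z, (∑ x, P (u, x) * ch.outZ x z) *
      Real.logb 2 ((∑ x, P (u, x) * ch.outZ x z) /
        ((∑ x, P (u, x)) * ∑ u', ∑ x, P (u', x) * ch.outZ x z)) * Real.log 2 =
      -Real.negMulLog (∑ x, P (u, x) * ch.outZ x z) -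
        (∑ x, P (u, x) * ch.outZ x z) * Real.log (∑ x, P (u, x)) -
        (∑ x, P (u, x) * ch.outZ x z) * Real.log (∑ u', ∑ x, P (u', x) * ch.outZ x z) := by
    intro u z
    by_cases h : ch.lawUZ P (u, z) = 0
    · simp only [lawUZ] at h
      simp [h]
    have h' : ¬ch.lawUxZ P (u, z) = 0 := fun h0 => h (ch.lawUZ_eq_zero_of_lawUxZ hP h0)
    simp only [lawUZ] at h
    simp only [lawUxZ, mul_eq_zero, not_or] at h'
    rw [Real.logb, mul_div_assoc', div_mul_cancel₀ _ hl, Real.log_div h (mul_ne_zero h'.1 h'.2),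
      Real.log_mul h'.1 h'.2, Real.negMulLog]
    ring
  simp only [infoUZ_eq, Finset.sum_mul (a := Real.log 2), hterm, hZ, Finset.sum_sub_distrib, outputEntropy]
  rw [Finset.sum_comm (f := fun u z => (∑ x, P (u, x) * ch.outZ x z) *
    Real.log (∑ u', ∑ x, P (u', x) * ch.outZ x z))]
  simp only [← Finset.sum_mul, hU, Finset.sum_neg_distrib]
  simp only [Real.negMulLog, neg_mul, Finset.sum_neg_distrib]
  ring

/-- This is `H(S,Y|U) - H(S,Y|X)` in nats, the last term being linear in the input marginal. -/
theorem infoXYgivenUS_mul_log {P : U × X → ℝ} (hP : ∀ a, 0 ≤ P a) :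
    ch.infoXYgivenUS P * Real.log 2 = ∑ u, outputEntropy ch.outSY (fun x => P (u, x)) +
      ∑ x, (∑ u, P (u, x)) * ∑ t, ch.outSY x t * Real.log (ch.outSY x t) := by
  have hl : Real.log 2 ≠ 0 := (Real.log_pos one_lt_two).ne'
  have h0 : ∀ u x t, 0 ≤ P (u, x) * ch.outSY x t := fun u x t =>
    mul_nonneg (hP _) ((ch.outSY_mem x).1 _)
  have hterm : ∀ u x t, P (u, x) * ch.outSY x t *
      Real.logb 2 (ch.outSY x t * (∑ x', P (u, x')) / ∑ x', P (u, x') * ch.outSY x' t) *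
        Real.log 2 =
      P (u, x) * (ch.outSY x t * Real.log (ch.outSY x t)) +
        ch.outSY x t * (P (u, x) * Real.log (∑ x', P (u, x'))) -
        P (u, x) * ch.outSY x t * Real.log (∑ x', P (u, x') * ch.outSY x' t) := by
    intro u x t
    by_cases h : P (u, x) * ch.outSY x t = 0
    · rcases mul_eq_zero.1 h with h | h <;> simp [h]
    have h1 := left_ne_zero_of_mul h
    have h2 := right_ne_zero_of_mul h
    have h3 : ∑ x', P (u, x') ≠ 0 := fun hs =>
      h1 ((Finset.sum_eq_zero_iff_of_nonneg fun x _ => hP (u, x)).1 hs x (Finset.mem_univ x))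
    have h4 : ∑ x', P (u, x') * ch.outSY x' t ≠ 0 := fun hs =>
      h ((Finset.sum_eq_zero_iff_of_nonneg fun x _ => h0 u x t).1 hs x (Finset.mem_univ x))
    rw [Real.logb, mul_div_assoc', div_mul_cancel₀ _ hl, Real.log_div (mul_ne_zero h2 h3) h4,
      Real.log_mul h2 h3]
    ring
  simp only [infoXYgivenUS_eq, Finset.sum_mul (a := Real.log 2), hterm, Finset.sum_sub_distrib,
    Finset.sum_add_distrib, ← Finset.mul_sum, outputEntropy]
  have e1 : ∑ u, ∑ x, P (u, x) * ∑ t, ch.outSY x t * Real.log (ch.outSY x t) =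
      ∑ x, (∑ u, P (u, x)) * ∑ t, ch.outSY x t * Real.log (ch.outSY x t) := by
    rw [Finset.sum_comm]
    simp only [Finset.sum_mul]
  have e2 : ∀ u, ∑ x, ∑ t, ch.outSY x t * (P (u, x) * Real.log (∑ x', P (u, x'))) =
      -Real.negMulLog (∑ x, P (u, x)) := by
    intro u
    simp only [← Finset.sum_mul, (ch.outSY_mem _).2, one_mul, Real.negMulLog, neg_mul, neg_neg]
  have e3 : ∀ u, ∑ x, ∑ t, P (u, x) * ch.outSY x t *
      Real.log (∑ x', P (u, x') * ch.outSY x' t) =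
      -∑ t, Real.negMulLog (∑ x, P (u, x) * ch.outSY x t) := by
    intro u
    rw [Finset.sum_comm]
    simp only [← Finset.sum_mul, Real.negMulLog, neg_mul, Finset.sum_neg_distrib, neg_neg]
  simp only [e1, e2, e3, Finset.sum_neg_distrib]
  ring

theorem infoXYgivenS_congr {U' : Type*} [Fintype U'] {P : U × X → ℝ} {P' : U' × X → ℝ}
    (hP : ∑ a, P a = 1) (hP' : ∑ a, P' a = 1) (h : ∀ x, ∑ u, P' (u, x) = ∑ u, P (u, x)) :
    ch.infoXYgivenS P' = ch.infoXYgivenS P := by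
  have hc : ∀ t, ∑ u, ∑ x, P' (u, x) * ch.outSY x t = ∑ u, ∑ x, P (u, x) * ch.outSY x t := by
    intro t
    rw [Finset.sum_comm, Finset.sum_comm (s := (Finset.univ : Finset U))]
    simp only [← Finset.sum_mul, h]
  simp only [infoXYgivenS_eq ch hP, infoXYgivenS_eq ch hP', h, hc]

/-- The joint weight of the state `s` and the output `z` for the input weights `r`. -/
def stateWeight (r : X → ℝ) (z : Z) (s : S) : ℝ := ∑ x, r x * ∑ y, ch.PS s * ch.W x s (y, z)

/-- The unnormalized expected distortion of the estimate `s'` given the output `z`. -/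
def estimateCost (r : X → ℝ) (z : Z) (s' : S) : ℝ := ∑ s, ch.stateWeight r z s * ch.d s s'

theorem law_SUZ (P : U × X → ℝ) (u : U) (z : Z) (s : S) :
    law (ch.joint P) (fun ω => (ω.2.2.1, ω.1, ω.2.2.2.2)) (s, u, z) =
      ch.stateWeight (fun x => P (u, x)) z s := by
  classical
  simp only [law_eq_sum_ite, Fintype.sum_prod_type, joint, Prod.mk.injEq, ite_and,
    sum_ite_zero_irrel, Finset.sum_ite_eq', Finset.mem_univ, if_true]
  simp [stateWeight, mul_assoc, ← Finset.mul_sum]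

theorem sum_stateWeight (r : X → ℝ) (z : Z) :
    ∑ s, ch.stateWeight r z s = ∑ x, r x * ch.outZ x z := by
  simp only [stateWeight, outZ]
  rw [Finset.sum_comm]
  simp only [← Finset.mul_sum]

theorem meanDistortion_eq (P : U × X → ℝ) (est : U → Z → S) :
    ch.meanDistortion P est = ∑ u, ∑ z, ch.estimateCost (fun x => P (u, x)) z (est u z) := by
  rw [meanDistortion, ← sum_law_mul (ch.joint P) (fun ω => (ω.2.2.1, ω.1, ω.2.2.2.2))
    (fun a => ch.d a.1 (est a.2.1 a.2.2)), Fintype.sum_prod_type, Finset.sum_comm,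
    Fintype.sum_prod_type]
  simp only [law_SUZ, estimateCost]

/-- Normalizing by the mass of `(u, z)` does not affect the comparison, and where that mass is zero
all costs vanish. -/
theorem isOneShotOptimal_iff {P : U × X → ℝ} (hP : ∀ a, 0 ≤ P a) (est : U → Z → S) :
    ch.IsOneShotOptimal P est ↔ ∀ u z s', ch.estimateCost (fun x => P (u, x)) z (est u z) ≤
      ch.estimateCost (fun x => P (u, x)) z s' := by
  have hpost : ∀ u z s', ∑ s, ch.posterior P u z s * ch.d s s' =
      ch.estimateCost (fun x => P (u, x)) z s' / ∑ x, P (u, x) * ch.outZ x z := by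
    intro u z s'
    have hp : ∀ s, ch.posterior P u z s = ch.stateWeight (fun x => P (u, x)) z s /
        ∑ x, P (u, x) * ch.outZ x z := by
      intro s
      rw [← law_SUZ, ← law_UZ]
      rfl
    simp only [hp, estimateCost, Finset.sum_div, div_mul_eq_mul_div]
  simp only [IsOneShotOptimal, hpost]
  refine forall_congr' fun u => forall_congr' fun z => forall_congr' fun s' => ?_
  have hw : ∀ s, 0 ≤ ch.stateWeight (fun x => P (u, x)) z s := fun s =>
    Finset.sum_nonneg fun x _ => mul_nonneg (hP _) (Finset.sum_nonneg fun y _ =>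
      mul_nonneg (ch.PS_mem.1 _) ((ch.W_mem _ _).1 _))
  have h0 : 0 ≤ ∑ x, P (u, x) * ch.outZ x z :=
    Finset.sum_nonneg fun x _ => mul_nonneg (hP _) ((ch.outZ_mem x).1 _)
  rcases h0.eq_or_lt with h | h
  · rw [← sum_stateWeight] at h
    have hz : ∀ s, ch.stateWeight (fun x => P (u, x)) z s = 0 := fun s =>
      (Finset.sum_eq_zero_iff_of_nonneg fun s _ => hw s).1 h.symm s (Finset.mem_univ s)
    simp [estimateCost, hz]
  · exact div_le_div_iff_of_pos_right h

theorem nonempty_state (ch : SDMBC X S Y Z) : Nonempty S := by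
  by_contra h
  rw [not_nonempty_iff] at h
  simpa using ch.PS_mem.2

/-- The minimal (unnormalized) expected distortion for the input weights `r`. -/
def minCost [Nonempty S] (r : X → ℝ) : ℝ :=
  ∑ z, Finset.univ.inf' Finset.univ_nonempty (ch.estimateCost r z)

theorem continuous_minCost [Nonempty S] : Continuous ch.minCost := by
  refine continuous_finsetSum _ fun z _ => Continuous.finset_inf'_apply _ fun s' _ => ?_
  unfold estimateCost stateWeight
  fun_prop

/-- Each cost is linear in the weights; a nonnegative factor passes through the minimum. -/
theorem minCost_smul [Nonempty S] {w : ℝ} (hw : 0 ≤ w) (r : X → ℝ) :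
    ch.minCost (w • r) = w * ch.minCost r := by
  have h : ∀ z s', ch.estimateCost (w • r) z s' = w * ch.estimateCost r z s' := fun z s' => by
    simp only [estimateCost, stateWeight, Pi.smul_apply, smul_eq_mul, Finset.mul_sum,
      Finset.sum_mul, mul_assoc]
  simp only [minCost, Finset.mul_sum]
  refine Finset.sum_congr rfl fun z _ => ?_
  rw [Finset.apply_inf'_eq_inf'_comp Finset.univ_nonempty (fun a => w * a)
    fun a b => mul_min_of_nonneg a b hw]
  exact Finset.inf'_congr _ rfl fun s' _ => h z s'

/-- Optimal estimators attain the minimum at every `(u, z)`, so the value does not depend on which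
one is chosen and splits over rows. -/
theorem oneShotDistortion_eq_sum_minCost [Nonempty S] {P : U × X → ℝ} (hP : ∀ a, 0 ≤ P a)
    {est : U → Z → S} (hest : ch.IsOneShotOptimal P est) :
    ch.oneShotDistortion P est = ∑ u, ch.minCost fun x => P (u, x) := by
  rw [oneShotDistortion_eq ch hP, meanDistortion_eq]
  refine Finset.sum_congr rfl fun u _ => Finset.sum_congr rfl fun z _ => le_antisymm ?_ ?_
  · exact Finset.le_inf' _ _ fun s' _ => (ch.isOneShotOptimal_iff hP est).1 hest u z s'
  · exact Finset.inf'_le _ (Finset.mem_univ _)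

theorem exists_isOneShotOptimal [Nonempty S] {P : U × X → ℝ} (hP : ∀ a, 0 ≤ P a) :
    ∃ est : U → Z → S, ch.IsOneShotOptimal P est := by
  choose est hest using fun (u : U) (z : Z) =>
    Finite.exists_min (ch.estimateCost (fun x => P (u, x)) z)
  exact ⟨est, (ch.isOneShotOptimal_iff hP est).2 hest⟩

theorem infos_eq_of_outputEntropy_eq {U' : Type*} [Fintype U'] {P : U × X → ℝ} {P' : U' × X → ℝ}
    (hP : P ∈ stdSimplex ℝ (U × X)) (hP' : P' ∈ stdSimplex ℝ (U' × X))
    (h : ∀ x, ∑ u, P' (u, x) = ∑ u, P (u, x))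
    (hZ : ∑ u, outputEntropy ch.outZ (fun x => P' (u, x)) =
      ∑ u, outputEntropy ch.outZ (fun x => P (u, x)))
    (hSY : ∑ u, outputEntropy ch.outSY (fun x => P' (u, x)) =
      ∑ u, outputEntropy ch.outSY (fun x => P (u, x))) :
    ch.infoUZ P' = ch.infoUZ P ∧ ch.infoXYgivenUS P' = ch.infoXYgivenUS P ∧
      ch.infoXYgivenS P' = ch.infoXYgivenS P := by
  have hl : Real.log 2 ≠ 0 := (Real.log_pos one_lt_two).ne'
  refine ⟨mul_right_cancel₀ hl ?_, mul_right_cancel₀ hl ?_,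
    ch.infoXYgivenS_congr hP.2 hP'.2 h⟩
  · rw [infoUZ_mul_log ch hP.1, infoUZ_mul_log ch hP'.1, hZ]
    simp only [h]
  · rw [infoXYgivenUS_mul_log ch hP.1, infoXYgivenUS_mul_log ch hP'.1, hSY]
    simp only [h]

end SDMBC

end ISAC

end

theorem theorem1 {U X S Y Z : Type*}
    [Fintype U] [Fintype X] [Fintype S] [Fintype Y] [Fintype Z]
    (ch : ISAC.SDMBC X S Y Z) (P : U × X → ℝ) (hP : P ∈ stdSimplex ℝ (U × X))
    (est : U → Z → S) (hest : ch.IsOneShotOptimal P est) :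
    -- achievability, on the closed and on the open rate region
    (∀ R₀ R₁ D : ℝ, 0 ≤ R₀ → 0 ≤ R₁ → ch.oneShotDistortion P est ≤ D →
      (R₀ ≤ ch.infoUZ P → R₁ ≤ ch.infoXYgivenUS P → R₀ + R₁ ≤ ch.infoXYgivenS P →
        (R₀, R₁, D) ∈ ch.capacityDistortionRegion) ∧
      ((R₀ = 0 ∨ R₀ < ch.infoUZ P) → (R₁ = 0 ∨ R₁ < ch.infoXYgivenUS P) →
        (R₀ + R₁ = 0 ∨ R₀ + R₁ < ch.infoXYgivenS P) → ch.IsAchievable R₀ R₁ D)) ∧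
    -- cardinality of the auxiliary alphabet, rate constraints
    (∃ k : ℕ, k ≤ Fintype.card X + 1 ∧ ∃ P' ∈ stdSimplex ℝ (Fin k × X),
      (∀ x, ∑ u, P' (u, x) = ∑ u, P (u, x)) ∧
      ch.infoUZ P' = ch.infoUZ P ∧ ch.infoXYgivenUS P' = ch.infoXYgivenUS P ∧
      ch.infoXYgivenS P' = ch.infoXYgivenS P) ∧
    -- cardinality of the auxiliary alphabet, rate and distortion constraints
    (∃ k : ℕ, k ≤ Fintype.card X + 2 ∧ ∃ P' ∈ stdSimplex ℝ (Fin k × X),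
      (∀ x, ∑ u, P' (u, x) = ∑ u, P (u, x)) ∧
      ch.infoUZ P' = ch.infoUZ P ∧ ch.infoXYgivenUS P' = ch.infoXYgivenUS P ∧
      ch.infoXYgivenS P' = ch.infoXYgivenS P ∧
      ∃ est' : Fin k → Z → S, ch.IsOneShotOptimal P' est' ∧
        ch.oneShotDistortion P' est' = ch.oneShotDistortion P est) := by
  have : Nonempty S := ch.nonempty_state
  refine ⟨fun R₀ R₁ D hR₀ hR₁ hD => ⟨fun h₀ h₁ h =>
    ch.mem_capacityDistortionRegion_of_le hP est hR₀ hR₁ hD h₀ h₁ h, fun h₀ h₁ h =>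
    ch.isAchievable_of_lt hP est hR₀ hR₁ hD h₀ h₁ h⟩, ?_, ?_⟩
  -- Two row functionals give `k + 1 ≤ |X| + 2`; the third, `minCost`, costs one more row in the
  -- next case.
  · obtain ⟨k, hk, P', hP', hX, hφ⟩ := ISAC.exists_support_reduction hP one_le_two
      ![ISAC.outputEntropy ch.outZ, ISAC.outputEntropy ch.outSY]
      (Fin.forall_fin_two.2
        ⟨ISAC.continuous_outputEntropy _, ISAC.continuous_outputEntropy _⟩)
      (Fin.forall_fin_two.2
        ⟨fun w r _ => ISAC.outputEntropy_smul (fun x => (ch.outZ_mem x).2) w r,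
          fun w r _ => ISAC.outputEntropy_smul (fun x => (ch.outSY_mem x).2) w r⟩)
    exact ⟨k, by omega, P', hP', hX, ch.infos_eq_of_outputEntropy_eq hP hP' hX (hφ 0) (hφ 1)⟩
  · obtain ⟨k, hk, P', hP', hX, hφ⟩ := ISAC.exists_support_reduction hP (m := 3) (by omega)
      ![ISAC.outputEntropy ch.outZ, ISAC.outputEntropy ch.outSY, ch.minCost]
      (Fin.forall_fin_succ.2 ⟨ISAC.continuous_outputEntropy _, Fin.forall_fin_two.2
        ⟨ISAC.continuous_outputEntropy _, ch.continuous_minCost⟩⟩)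
      (Fin.forall_fin_succ.2
        ⟨fun w r _ => ISAC.outputEntropy_smul (fun x => (ch.outZ_mem x).2) w r,
        Fin.forall_fin_two.2
          ⟨fun w r _ => ISAC.outputEntropy_smul (fun x => (ch.outSY_mem x).2) w r,
            fun w r hw => ch.minCost_smul hw r⟩⟩)
    obtain ⟨h1, h2, h3⟩ := ch.infos_eq_of_outputEntropy_eq hP hP' hX (hφ 0) (hφ 1)
    obtain ⟨est', hest'⟩ := ch.exists_isOneShotOptimal hP'.1
    refine ⟨k, by omega, P', hP', hX, h1, h2, h3, est', hest', ?_⟩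
    rw [ch.oneShotDistortion_eq_sum_minCost hP'.1 hest',
      ch.oneShotDistortion_eq_sum_minCost hP.1 hest]
    exact hφ 2
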